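/- Let $(B,g_B)$ and $(F,g_F)$ be smooth pseudo-Riemannian manifolds (without boundary) of dimensions $m\ge 3$ and $k\ge 1$, let $\psi\colon B\to(0,\infty)$ be smooth, and let $\mu\in\mathbb{R}\setminus\{0,1,\overline{\mu},\overline{\mu}_{+},\overline{\mu}_{-}\}$, where $$\overline{\mu}=-\frac{k}{m-2},\qquad \overline{\mu}_{\pm}=\overline{\mu}\pm\sqrt{\overline{\mu}^2-\overline{\mu}}.$$ Put $$\alpha^{\Delta}=\frac{1}{(m-2)\mu+k},\qquad \beta^{\Delta}=\frac{\mu}{(m-2)\mu+k},$$ $$\alpha^{H}=\frac{-[(m-2)\mu+k]}{\mu[(m-2)\mu+k]+k(\mu-1)},\qquad \beta^{H}=\frac{[(m-2)\mu+k]^2}{\mu[(m-2)\mu+k]+k(\mu-1)}.$$ For a smooth function $v$ on $B$ let $H_B^{v}$ be its Hessian, $H_B^v(X,Y)=XYv-(\nabla_XY)v$, where $\nabla$ is the Levi-Civita connection of $g_B$, and let $\Delta_B v=\nabla^i\nabla_i v$ be its Laplacian, the trace of $H_B^v$ with respect to $g_B$. The Ricci tensor is $\mathrm{Ric}(Y,Z)=\operatorname{tr}(X\mapsto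 R(X,Y)Z)$ with $R(X,Y)Z=\nabla_X\nabla_YZ-\nabla_Y\nabla_XZ-\nabla_{[X,Y]}Z$. Let $\mathrm{Ric}$, $\mathrm{Ric}_B$, $\mathrm{Ric}_F$ be the Ricci tensors of the metric $g=\psi^{2\mu}g_B+\psi^2g_F$ on $B\times F$, of $g_B$ and of $g_F$. Then at every point of $B\times F$: (1) for lifts to $B\times F$ of tangent vectors $X,Y$ of $B$, $$\mathrm{Ric}(X,Y)=\mathrm{Ric}_B(X,Y)+\beta^{H}\frac{1}{\psi^{1/\alpha^{H}}}H_B^{\psi^{1/\alpha^{H}}}(X,Y)-\beta^{\Delta}\frac{1}{\psi^{1/\alpha^{\Delta}}}\,\Delta_B\bigl(\psi^{1/\alpha^{\Delta}}\bigr)\,g_B(X,Y);$$ (2) if $X$ is the lift of a tangent vector of $B$ and $V$ is the lift of a tangent vector of $F$, then $\mathrm{Ric}(X,V)=\mathrm{Ric}(V,X)=0$; (3) for lifts of tangent vectors $V,W$ of $F$, $$\mathrm{Ric}(V,W)=\mathrm{Ric}_F(V,W)-\frac{1}{\psi^{2(\mu-1)}}\,\frac{\beta^{\Delta}}{\mu}\,\frac{1}{\psi^{1/\alpha^{\Delta}}}\,\Delta_B\bigl(\psi^{1/\alpha^{\Delta}}\bigr)\,g_F(V,W).$$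 -/

import Mathlib

set_option maxSynthPendingDepth 3

open Bundle Manifold ContDiff

/-! ### Coordinate formulas

`G` is a metric in coordinates: a function on the finite-dimensional model space `E` with values in
the bilinear forms on `E`.  Coordinates are given by `E` itself, so that no basis is needed. -/

section Coordinates

variable {E : Type*} [NormedAddCommGroup E] [NormedSpace ℝ E]

/-- Christoffel symbols of the first kind:
`christoffelFirst G y u v w = (∂_u G (v, w) + ∂_v G (u, w) - ∂_w G (u, v)) / 2` at `y`. -/
noncomputable def christoffelFirst (G : E → E →L[ℝ] E →L[ℝ] ℝ) (y : E) :
    E →L[ℝ] E →L[ℝ] E →L[ℝ] ℝ :=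
  let D : E →L[ℝ] E →L[ℝ] E →L[ℝ] ℝ := fderiv ℝ G y
  let S : E →L[ℝ] E →L[ℝ] E →L[ℝ] ℝ :=
    (ContinuousLinearMap.flipₗᵢ ℝ E E ℝ).toContinuousLinearEquiv.toContinuousLinearMap ∘L D.flip
  (1 / 2 : ℝ) • (D + D.flip - S)

theorem christoffelFirst_apply (G : E → E →L[ℝ] E →L[ℝ] ℝ) (y u v w : E) :
    christoffelFirst G y u v w =
      1 / 2 * (fderiv ℝ G y u v w + fderiv ℝ G y v u w - fderiv ℝ G y w u v) := rfl

/-- Christoffel symbols of the second kind: `christoffel G y u v` is the vector `Γ(u, v) = ∇_u v` at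
`y` (for constant `u`, `v`) with `G y (Γ(u, v)) w = christoffelFirst G y u v w` for all `w`.  Here
`(G y).inverse` is the inverse of `G y : E → E*`, that is, the operation of raising an index. -/
noncomputable def christoffel (G : E → E →L[ℝ] E →L[ℝ] ℝ) (y : E) : E →L[ℝ] E →L[ℝ] E :=
  (ContinuousLinearMap.compL ℝ E (E →L[ℝ] ℝ) E (G y).inverse) ∘L christoffelFirst G y

theorem christoffel_apply (G : E → E →L[ℝ] E →L[ℝ] ℝ) (y u v : E) :
    christoffel G y u v = (G y).inverse (christoffelFirst G y u v) := rfl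

/-- For fixed `v`, `w`, the endomorphism `u ↦ R(u, v) w` of the model space, where
`R(u, v) w = ∇_u ∇_v w - ∇_v ∇_u w` (for constant `u`, `v`, `w`) is the curvature of the
Levi-Civita connection. -/
noncomputable def coordCurvature (G : E → E →L[ℝ] E →L[ℝ] ℝ) (y v w : E) : E →L[ℝ] E :=
  ((fderiv ℝ (christoffel G) y).flip v).flip w - (fderiv ℝ (christoffel G) y v).flip w +
    (christoffel G y).flip (christoffel G y v w) -
    christoffel G y v ∘L (christoffel G y).flip w

theorem coordCurvature_apply (G : E → E →L[ℝ] E →L[ℝ] ℝ) (y u v w : E) :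
    coordCurvature G y v w u =
      fderiv ℝ (christoffel G) y u v w - fderiv ℝ (christoffel G) y v u w +
        christoffel G y u (christoffel G y v w) - christoffel G y v (christoffel G y u w) := rfl

/-- The Ricci tensor in coordinates, `Ric(v, w) = trace (u ↦ R(u, v) w)` (so that round spheres
have positive Ricci curvature). -/
noncomputable def coordRicci (G : E → E →L[ℝ] E →L[ℝ] ℝ) (y v w : E) : ℝ :=
  LinearMap.trace ℝ E (coordCurvature G y v w : E →ₗ[ℝ] E)

/-- The Hessian in coordinates, `H(u, v) = u (v f) - (∇_u v) f` for constant `u`, `v`. -/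
noncomputable def coordHessian (G : E → E →L[ℝ] E →L[ℝ] ℝ) (f : E → ℝ) (y : E) :
    E →L[ℝ] E →L[ℝ] ℝ :=
  fderiv ℝ (fderiv ℝ f) y -
    (ContinuousLinearMap.compL ℝ E E ℝ (fderiv ℝ f y)) ∘L christoffel G y

theorem coordHessian_apply (G : E → E →L[ℝ] E →L[ℝ] ℝ) (f : E → ℝ) (y u v : E) :
    coordHessian G f y u v =
      fderiv ℝ (fderiv ℝ f) y u v - fderiv ℝ f y (christoffel G y u v) := rfl

/-- The Laplace-Beltrami operator in coordinates: the trace of the Hessian with respect to the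
metric, `∇^i ∇_i f`. -/
noncomputable def coordLaplacian (G : E → E →L[ℝ] E →L[ℝ] ℝ) (f : E → ℝ) (y : E) : ℝ :=
  LinearMap.trace ℝ E (((G y).inverse ∘L coordHessian G f y : E →L[ℝ] E) : E →ₗ[ℝ] E)

end Coordinates

/-! ### Pseudo-Riemannian manifolds -/

section Manifolds

variable {E : Type*} [NormedAddCommGroup E] [NormedSpace ℝ E]
  {H : Type*} [TopologicalSpace H] (I : ModelWithCorners ℝ E H)
  (M : Type*) [TopologicalSpace M] [ChartedSpace H M] [IsManifold I ∞ M]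

/-- A smooth pseudo-Riemannian metric on `M`: a smooth symmetric nondegenerate `(0,2)`-tensor
field. -/
structure PseudoRiemannianMetric where
  /-- The scalar product on the tangent spaces. -/
  val (x : M) : TangentSpace I x →L[ℝ] TangentSpace I x →L[ℝ] ℝ
  symm (x : M) (u v : TangentSpace I x) : val x u v = val x v u
  nondegenerate (x : M) (u : TangentSpace I x) : (∀ v, val x u v = 0) → u = 0
  contMDiff : ContMDiff I (I.prod 𝓘(ℝ, E →L[ℝ] E →L[ℝ] ℝ)) ∞
    (fun x ↦ TotalSpace.mk' (E →L[ℝ] E →L[ℝ] ℝ)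
      (E := fun x ↦ TangentSpace I x →L[ℝ] TangentSpace I x →L[ℝ] ℝ) x (val x))

variable {I M}

/-- For `y` in the target of the chart at `x`, the map sending a coordinate vector to the
corresponding tangent vector of `M` at the point with coordinates `y`. -/
noncomputable def coordFrame (x : M) (y : E) :
    E →L[ℝ] TangentSpace I ((extChartAt I x).symm y) :=
  mfderivWithin 𝓘(ℝ, E) I (extChartAt I x).symm (Set.range I) y

/-- The coordinates, in the chart at `x`, of a tangent vector at `x`. -/
noncomputable def tangentCoord (x : M) : TangentSpace I x →L[ℝ] E :=
  mfderiv I 𝓘(ℝ, E) (extChartAt I x) x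

namespace PseudoRiemannianMetric

/-- The metric read in the chart at `x`. -/
noncomputable def inChart (g : PseudoRiemannianMetric I M) (x : M) (y : E) : E →L[ℝ] E →L[ℝ] ℝ :=
  let G : E →L[ℝ] E →L[ℝ] ℝ := g.val ((extChartAt I x).symm y)
  let A : E →L[ℝ] E := coordFrame (I := I) x y
  G.bilinearComp A A

/-- The Ricci tensor of `g` at `x` (`M` without boundary, of finite dimension), computed in the
chart at `x`. -/
noncomputable def ricci (g : PseudoRiemannianMetric I M) (x : M) (u v : TangentSpace I x) : ℝ :=
  coordRicci (g.inChart x) (extChartAt I x x) (tangentCoord x u) (tangentCoord x v)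

/-- The Hessian of `f` with respect to `g` at `x` (`M` without boundary, of finite dimension),
computed in the chart at `x`. -/
noncomputable def hessian (g : PseudoRiemannianMetric I M) (f : M → ℝ) (x : M)
    (u v : TangentSpace I x) : ℝ :=
  coordHessian (g.inChart x) (f ∘ (extChartAt I x).symm) (extChartAt I x x)
    (tangentCoord x u) (tangentCoord x v)

/-- The Laplace-Beltrami operator of `g` (`M` without boundary, of finite dimension), computed at
`x` in the chart at `x`. -/
noncomputable def laplacian (g : PseudoRiemannianMetric I M) (f : M → ℝ) (x : M) : ℝ :=
  coordLaplacian (g.inChart x) (f ∘ (extChartAt I x).symm) (extChartAt I x x)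

end PseudoRiemannianMetric

end Manifolds

/-! ### Base conformal warped products -/

theorem contMDiff_rpow_of_pos {E : Type*} [NormedAddCommGroup E] [NormedSpace ℝ E]
    {H : Type*} [TopologicalSpace H] {I : ModelWithCorners ℝ E H}
    {B : Type*} [TopologicalSpace B] [ChartedSpace H B] {ψ : B → ℝ}
    (hψ : ContMDiff I 𝓘(ℝ, ℝ) ∞ ψ) (hψ₀ : ∀ b, 0 < ψ b) (μ : ℝ) :
    ContMDiff I 𝓘(ℝ, ℝ) ∞ (fun b ↦ ψ b ^ μ) := fun b ↦
  ((Real.contDiffAt_rpow_const_of_ne (hψ₀ b).ne').contMDiffAt).comp b (hψ b)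

section WarpedProduct

variable {E : Type*} [NormedAddCommGroup E] [NormedSpace ℝ E]
  {H : Type*} [TopologicalSpace H] {I : ModelWithCorners ℝ E H}
  {B : Type*} [TopologicalSpace B] [ChartedSpace H B] [IsManifold I ∞ B]
  {E' : Type*} [NormedAddCommGroup E'] [NormedSpace ℝ E']
  {H' : Type*} [TopologicalSpace H'] {J : ModelWithCorners ℝ E' H'}
  {F : Type*} [TopologicalSpace F] [ChartedSpace H' F] [IsManifold J ∞ F]

/-- The tensor field `c² g_B + w² g_F` on `B × F`. -/
noncomputable def bcwpVal (gB : PseudoRiemannianMetric I B) (gF : PseudoRiemannianMetric J F)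
    (c w : B → ℝ) (p : B × F) :
    TangentSpace (I.prod J) p →L[ℝ] TangentSpace (I.prod J) p →L[ℝ] ℝ :=
  let dπ : E × E' →L[ℝ] E := mfderiv (I.prod J) I Prod.fst p
  let dσ : E × E' →L[ℝ] E' := mfderiv (I.prod J) J Prod.snd p
  let GB : E →L[ℝ] E →L[ℝ] ℝ := gB.val p.1
  let GF : E' →L[ℝ] E' →L[ℝ] ℝ := gF.val p.2
  (c p.1 ^ 2) • GB.bilinearComp dπ dπ + (w p.1 ^ 2) • GF.bilinearComp dσ dσ

theorem bcwpVal_apply (gB : PseudoRiemannianMetric I B) (gF : PseudoRiemannianMetric J F)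
    (c w : B → ℝ) (p : B × F) (u₁ v₁ : TangentSpace I p.1) (u₂ v₂ : TangentSpace J p.2) :
    bcwpVal gB gF c w p (u₁, u₂) (v₁, v₂) =
      c p.1 ^ 2 * gB.val p.1 u₁ v₁ + w p.1 ^ 2 * gF.val p.2 u₂ v₂ := by
  unfold bcwpVal
  rw [mfderiv_fst, mfderiv_snd]
  rfl

theorem symmL_prod (p₀ p : B × F) (hp : p ∈ (chartAt (ModelProd H H') p₀).source) (v : E × E') :
    (trivializationAt (E × E') (TangentSpace (I.prod J)) p₀).symmL ℝ p v =
      ((trivializationAt E (TangentSpace I) p₀.1).symmL ℝ p.1 v.1,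
        (trivializationAt E' (TangentSpace J) p₀.2).symmL ℝ p.2 v.2) := by
  have : IsManifold I 1 B := .of_le (n := ∞) (by simp)
  have : IsManifold J 1 F := .of_le (n := ∞) (by simp)
  have hp1 : p.1 ∈ (chartAt H p₀.1).source := hp.1
  have hp2 : p.2 ∈ (chartAt H' p₀.2).source := hp.2
  rw [TangentBundle.symmL_trivializationAt hp, TangentBundle.symmL_trivializationAt hp1,
    TangentBundle.symmL_trivializationAt hp2]
  have h1 := mdifferentiableWithinAt_extChartAt_symm (I := I) (x := p₀.1)
    (z := extChartAt I p₀.1 p.1) ((extChartAt I p₀.1).map_source (by rwa [extChartAt_source]))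
  have h2 := mdifferentiableWithinAt_extChartAt_symm (I := J) (x := p₀.2)
    (z := extChartAt J p₀.2 p.2) ((extChartAt J p₀.2).map_source (by rwa [extChartAt_source]))
  have h3 : UniqueMDiffWithinAt 𝓘(ℝ, E) (Set.range I) (extChartAt I p₀.1 p.1) :=
    uniqueMDiffWithinAt_iff_uniqueDiffWithinAt.2
      (I.uniqueDiffOn _ (extChartAt_target_subset_range p₀.1
        ((extChartAt I p₀.1).map_source (by rwa [extChartAt_source]))))
  have h4 : UniqueMDiffWithinAt 𝓘(ℝ, E') (Set.range J) (extChartAt J p₀.2 p.2) :=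
    uniqueMDiffWithinAt_iff_uniqueDiffWithinAt.2
      (J.uniqueDiffOn _ (extChartAt_target_subset_range p₀.2
        ((extChartAt J p₀.2).map_source (by rwa [extChartAt_source]))))
  have h := mfderivWithin_prodMap (p := (extChartAt I p₀.1 p.1, extChartAt J p₀.2 p.2)) h1 h2 h3 h4
  rw [extChartAt_prod, ModelWithCorners.range_prod, modelWithCornersSelf_prod,
    ← chartedSpaceSelf_prod]
  exact congrArg (fun L : E × E' →L[ℝ] E × E' ↦ L v) h

theorem inCoordinates_apply_symmL (x₀ x : B) (hx : x ∈ (chartAt H x₀).source)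
    (φ : TangentSpace I x →L[ℝ] TangentSpace I x →L[ℝ] ℝ) (u v : E) :
    ContinuousLinearMap.inCoordinates E (TangentSpace I) (E →L[ℝ] ℝ)
      (fun x ↦ TangentSpace I x →L[ℝ] ℝ) x₀ x x₀ x φ u v =
      φ ((trivializationAt E (TangentSpace I) x₀).symmL ℝ x u)
        ((trivializationAt E (TangentSpace I) x₀).symmL ℝ x v) := by
  rw [Trivialization.symmL_apply _ (show x ∈ (trivializationAt E (TangentSpace I) x₀).baseSet from hx),
    Trivialization.symmL_apply _ (show x ∈ (trivializationAt E (TangentSpace I) x₀).baseSet from hx)]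
  refine (inCoordinates_apply_eq₂ (F₃ := ℝ) (E₃ := Bundle.Trivial B ℝ) (ϕ := φ) (v := u) (w := v)
    hx hx (Set.mem_univ _)).trans ?_
  simp

theorem contMDiff_bcwpVal (gB : PseudoRiemannianMetric I B) (gF : PseudoRiemannianMetric J F)
    (c w : B → ℝ) (hc : ContMDiff I 𝓘(ℝ, ℝ) ∞ c) (hw : ContMDiff I 𝓘(ℝ, ℝ) ∞ w) :
    ContMDiff (I.prod J) ((I.prod J).prod 𝓘(ℝ, (E × E') →L[ℝ] (E × E') →L[ℝ] ℝ)) ∞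
    (fun p : B × F ↦ TotalSpace.mk' ((E × E') →L[ℝ] (E × E') →L[ℝ] ℝ)
      (E := fun p ↦ TangentSpace (I.prod J) p →L[ℝ] TangentSpace (I.prod J) p →L[ℝ] ℝ) p
      (bcwpVal gB gF c w p)) := by
  intro p₀
  have hB := ((contMDiffAt_hom_bundle _).1 (gB.contMDiff p₀.1)).2
  have hF := ((contMDiffAt_hom_bundle _).1 (gF.contMDiff p₀.2)).2
  refine (contMDiffAt_hom_bundle _).2 ⟨contMDiffAt_id, ?_⟩
  let PB : (E →L[ℝ] E →L[ℝ] ℝ) →L[ℝ] (E × E' →L[ℝ] E × E' →L[ℝ] ℝ) :=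
    (ContinuousLinearMap.precomp (E × E' →L[ℝ] ℝ) (ContinuousLinearMap.fst ℝ E E')) ∘L
      (ContinuousLinearMap.compL ℝ E (E →L[ℝ] ℝ) (E × E' →L[ℝ] ℝ)
        (ContinuousLinearMap.precomp ℝ (ContinuousLinearMap.fst ℝ E E')))
  let PF : (E' →L[ℝ] E' →L[ℝ] ℝ) →L[ℝ] (E × E' →L[ℝ] E × E' →L[ℝ] ℝ) :=
    (ContinuousLinearMap.precomp (E × E' →L[ℝ] ℝ) (ContinuousLinearMap.snd ℝ E E')) ∘L
      (ContinuousLinearMap.compL ℝ E' (E' →L[ℝ] ℝ) (E × E' →L[ℝ] ℝ)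
        (ContinuousLinearMap.precomp ℝ (ContinuousLinearMap.snd ℝ E E')))
  have h1 : ContMDiffAt (I.prod J) I ∞ (Prod.fst : B × F → B) p₀ := contMDiffAt_fst
  have h2 : ContMDiffAt (I.prod J) J ∞ (Prod.snd : B × F → F) p₀ := contMDiffAt_snd
  have hB' := PB.contMDiff.contMDiffAt.comp p₀ (hB.comp p₀ h1)
  have hF' := PF.contMDiff.contMDiffAt.comp p₀ (hF.comp p₀ h2)
  have hc' := ((hc p₀.1).comp p₀ h1)
  have hw' := ((hw p₀.1).comp p₀ h1)
  have key := ((hc'.mul hc').smul hB').add ((hw'.mul hw').smul hF')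
  refine key.congr_of_eventuallyEq ?_
  filter_upwards [(chartAt (ModelProd H H') p₀).open_source.mem_nhds
    (mem_chart_source (ModelProd H H') p₀)] with p hp
  have hp1 : p.1 ∈ (chartAt H p₀.1).source := hp.1
  have hp2 : p.2 ∈ (chartAt H' p₀.2).source := hp.2
  refine ContinuousLinearMap.ext fun u ↦ ContinuousLinearMap.ext fun v ↦ ?_
  refine (inCoordinates_apply_symmL p₀ p hp _ u v).trans ?_
  rw [symmL_prod p₀ p hp u, symmL_prod p₀ p hp v]
  refine (bcwpVal_apply gB gF c w p _ _ _ _).trans ?_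
  rw [← inCoordinates_apply_symmL p₀.1 p.1 hp1, ← inCoordinates_apply_symmL p₀.2 p.2 hp2,
    pow_two, pow_two]
  rfl

/-- The `[c, w]`-base conformal warped product metric `c² g_B + w² g_F` on `B × F`. -/
noncomputable def bcwp (gB : PseudoRiemannianMetric I B) (gF : PseudoRiemannianMetric J F)
    (c w : B → ℝ) (hc : ContMDiff I 𝓘(ℝ, ℝ) ∞ c) (hw : ContMDiff I 𝓘(ℝ, ℝ) ∞ w)
    (hc₀ : ∀ b, 0 < c b) (hw₀ : ∀ b, 0 < w b) :
    PseudoRiemannianMetric (I.prod J) (B × F) where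
  val := bcwpVal gB gF c w
  symm := by
    rintro p ⟨u₁, u₂⟩ ⟨v₁, v₂⟩
    refine (bcwpVal_apply gB gF c w p u₁ v₁ u₂ v₂).trans ?_
    rw [gB.symm p.1 u₁ v₁, gF.symm p.2 u₂ v₂]
    exact (bcwpVal_apply gB gF c w p v₁ u₁ v₂ u₂).symm
  nondegenerate := by
    rintro p ⟨u₁, u₂⟩ h
    refine Prod.ext (gB.nondegenerate p.1 u₁ fun v ↦ ?_) (gF.nondegenerate p.2 u₂ fun v ↦ ?_)
    · have h' := (bcwpVal_apply gB gF c w p u₁ v u₂ 0).symm.trans (h (v, 0))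
      rw [map_zero, mul_zero, add_zero] at h'
      exact (mul_eq_zero.1 h').resolve_left (pow_ne_zero 2 (hc₀ p.1).ne')
    · have h' := (bcwpVal_apply gB gF c w p u₁ 0 u₂ v).symm.trans (h (0, v))
      rw [map_zero, mul_zero, zero_add] at h'
      exact (mul_eq_zero.1 h').resolve_left (pow_ne_zero 2 (hw₀ p.1).ne')
  contMDiff := contMDiff_bcwpVal gB gF c w hc hw

/-- The special case `c = ψ^μ`, `w = ψ`: the `(ψ, μ)`-base conformal warped product metric
`ψ^{2μ} g_B + ψ² g_F` on `B × F`. -/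
noncomputable def sbcwp (gB : PseudoRiemannianMetric I B) (gF : PseudoRiemannianMetric J F)
    (ψ : B → ℝ) (μ : ℝ) (hψ : ContMDiff I 𝓘(ℝ, ℝ) ∞ ψ) (hψ₀ : ∀ b, 0 < ψ b) :
    PseudoRiemannianMetric (I.prod J) (B × F) :=
  bcwp gB gF (fun b ↦ ψ b ^ μ) ψ (contMDiff_rpow_of_pos hψ hψ₀ μ) hψ
    (fun b ↦ Real.rpow_pos_of_pos (hψ₀ b) μ) hψ₀

end WarpedProduct

/-! ### Lifts of tangent vectors to the product -/

section Lifts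

variable {E : Type*} [NormedAddCommGroup E] [NormedSpace ℝ E]
  {H : Type*} [TopologicalSpace H] {I : ModelWithCorners ℝ E H}
  {B : Type*} [TopologicalSpace B] [ChartedSpace H B]
  {E' : Type*} [NormedAddCommGroup E'] [NormedSpace ℝ E']
  {H' : Type*} [TopologicalSpace H'] {J : ModelWithCorners ℝ E' H'}
  {F : Type*} [TopologicalSpace F] [ChartedSpace H' F]

/-- The lift of a tangent vector of `B` to the point `(b, f)` of `B × F`: it projects to `u` on `B`
and to `0` on `F`. -/
noncomputable def baseLift {b : B} (u : TangentSpace I b) (f : F) : TangentSpace (I.prod J) (b, f) :=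
  (u, (0 : TangentSpace J f))

/-- The lift of a tangent vector of `F` to the point `(b, f)` of `B × F`: it projects to `0` on `B`
and to `z` on `F`. -/
noncomputable def fiberLift (b : B) {f : F} (z : TangentSpace J f) : TangentSpace (I.prod J) (b, f) :=
  ((0 : TangentSpace I b), z)

theorem mfderiv_fst_baseLift {b : B} (u : TangentSpace I b) (f : F) :
    mfderiv (I.prod J) I (Prod.fst : B × F → B) (b, f) (baseLift u f) = u := by
  rw [mfderiv_fst]
  rfl

theorem mfderiv_snd_baseLift {b : B} (u : TangentSpace I b) (f : F) :
    mfderiv (I.prod J) J (Prod.snd : B × F → F) (b, f) (baseLift u f) = 0 := by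
  rw [mfderiv_snd]
  rfl

theorem mfderiv_fst_fiberLift (b : B) {f : F} (z : TangentSpace J f) :
    mfderiv (I.prod J) I (Prod.fst : B × F → B) (b, f) (fiberLift b z) = 0 := by
  rw [mfderiv_fst]
  rfl

theorem mfderiv_snd_fiberLift (b : B) {f : F} (z : TangentSpace J f) :
    mfderiv (I.prod J) J (Prod.snd : B × F → F) (b, f) (fiberLift b z) = z := by
  rw [mfderiv_snd]
  rfl

end Lifts

/-!
Write `ψ = e^σ`.  Then `g = ψ^{2μ} g_B + ψ² g_F = e^{2σ} (e^{2(μ-1)σ} g_B + g_F)`, so that `g` arises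
from `g_B` by a conformal change, a product with `g_F` and a second conformal change.  In dimension
`n`, the metric `e^{2φ} G` has the Ricci tensor
`Ric - (n - 2) (∇dφ - dφ ⊗ dφ) - (Δφ + (n - 2) |dφ|²) G`
(`IsMetricAt.coordRicci_conformalChange`), which comes from the difference
`dφ(v) w + dφ(w) v - G(v, w) grad φ` of the Christoffel symbols; the Ricci tensor of a product is
the sum of those of the factors (`IsMetricAt.coordRicci_prodMetric`).  With `D = (m - 2) μ + k` and
`Q = μ D + k (μ - 1)` this yields (`coordRicci_warpedProduct`)
`Ric = Ric_B + Ric_F - D ∇dσ + Q dσ ⊗ dσ - (Δσ + D |dσ|²) (μ g_B + e^{2(1-μ)σ} g_F)`.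

On the other side, `ψ^{-a} ∇d(ψ^a) = a ∇dσ + a² dσ ⊗ dσ` (`hessian_rpow`), and
`ψ^{-a} Δ(ψ^a) = a Δσ + a² |dσ|²` (`laplacian_rpow`).  The exponents `1 / α^H = -Q / D` and
`1 / α^Δ = D` and the factors `β^H = D² / Q` and `β^Δ = μ / D` are those for which the first- and
second-order terms agree: `β^H / α^H = -D`, `β^H / (α^H)² = Q`, `β^Δ / α^Δ = μ` and
`β^Δ / (α^Δ)² = μ D`.  The excluded values of `μ` guarantee that `D`, `Q` and `μ` do not vanish.

All geometric objects are computed in charts.  The chart of `B × F` at a point is the product of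
charts (`inChart_bcwp_apply`), and Mathlib's identification of the tangent space at the centre of a
chart with the model space is the one given by that chart (`tangentCoord_eq_id`), so that lifts are
vectors of the form `(u, 0)` and `(0, z)` in coordinates.
-/

/-! ### Metrics in coordinates and their Christoffel symbols -/

section CoordinateMetric

open Filter Topology

variable {E : Type*} [NormedAddCommGroup E] [NormedSpace ℝ E]

/-- `G` is a pseudo-Riemannian metric of class `C²` near the point `y` of the model space.
Invertibility is only asked for at `y`; it spreads to a neighbourhood by continuity. -/
structure IsMetricAt (G : E → E →L[ℝ] E →L[ℝ] ℝ) (y : E) : Prop where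
  contDiffAt : ContDiffAt ℝ 2 G y
  eventually_symm : ∀ᶠ z in 𝓝 y, ∀ u v, G z u v = G z v u
  isInvertible : (G y).IsInvertible

/-- The gradient of `φ` with respect to the metric `G`. -/
noncomputable def coordGradient (G : E → E →L[ℝ] E →L[ℝ] ℝ) (φ : E → ℝ) (y : E) : E :=
  (G y).inverse (fderiv ℝ φ y)

/-- The Hessian of `φ` with one index raised, as an endomorphism: the covariant derivative
`u ↦ ∇_u grad φ` of the gradient. -/
noncomputable def hessianOperator (G : E → E →L[ℝ] E →L[ℝ] ℝ) (φ : E → ℝ) (y : E) : E →L[ℝ] E :=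
  (G y).inverse ∘L coordHessian G φ y

variable {G : E → E →L[ℝ] E →L[ℝ] ℝ} {φ : E → ℝ} {y : E}

theorem trace_hessianOperator (G : E → E →L[ℝ] E →L[ℝ] ℝ) (φ : E → ℝ) (y : E) :
    LinearMap.trace ℝ E (hessianOperator G φ y : E →ₗ[ℝ] E) = coordLaplacian G φ y := rfl

theorem trace_coordCurvature (G : E → E →L[ℝ] E →L[ℝ] ℝ) (y v w : E) :
    LinearMap.trace ℝ E (coordCurvature G y v w : E →ₗ[ℝ] E) = coordRicci G y v w := rfl

theorem fderiv_clm_apply_apply {E₁ E₂ E₃ : Type*} [NormedAddCommGroup E₁] [NormedSpace ℝ E₁]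
    [NormedAddCommGroup E₂] [NormedSpace ℝ E₂] [NormedAddCommGroup E₃] [NormedSpace ℝ E₃]
    {A : E → E₁ →L[ℝ] E₂ →L[ℝ] E₃} (hA : DifferentiableAt ℝ A y) (u : E) (v : E₁) (w : E₂) :
    fderiv ℝ (fun z ↦ A z v w) y u = fderiv ℝ A y u v w := by
  have h : HasFDerivAt (fun z ↦ A z v w) (((fderiv ℝ A y).flip v).flip w) y := by
    simpa using (hA.hasFDerivAt.clm_apply (hasFDerivAt_const v y)).clm_apply
      (hasFDerivAt_const w y)
  rw [h.fderiv]
  rfl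

theorem fderiv_clm_apply_const {E₁ E₂ : Type*} [NormedAddCommGroup E₁] [NormedSpace ℝ E₁]
    [NormedAddCommGroup E₂] [NormedSpace ℝ E₂]
    {A : E → E₁ →L[ℝ] E₂} (hA : DifferentiableAt ℝ A y) (u : E) (v : E₁) :
    fderiv ℝ (fun z ↦ A z v) y u = fderiv ℝ A y u v := by
  have h : HasFDerivAt (fun z ↦ A z v) ((fderiv ℝ A y).flip v) y := by
    simpa using hA.hasFDerivAt.clm_apply (hasFDerivAt_const v y)
  rw [h.fderiv]
  rfl

theorem differentiableAt_fderiv (hφ : ContDiffAt ℝ 2 φ y) : DifferentiableAt ℝ (fderiv ℝ φ) y :=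
  (hφ.fderiv_right (m := 1) (by norm_num)).differentiableAt (by simp)

theorem isInvertible_of_nondegenerate [FiniteDimensional ℝ E] (A : E →L[ℝ] E →L[ℝ] ℝ)
    (hA : ∀ u, (∀ v, A u v = 0) → u = 0) : A.IsInvertible := by
  let A' : E →ₗ[ℝ] Module.Dual ℝ E :=
    (LinearMap.toContinuousLinearMap (𝕜 := ℝ) (E := E) (F' := ℝ)).symm.toLinearMap ∘ₗ
      (A : E →ₗ[ℝ] E →L[ℝ] ℝ)
  have hA' : Function.Injective A' :=
    (injective_iff_map_eq_zero A').2 fun u hu ↦ hA u fun v ↦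
      congrArg (fun L : Module.Dual ℝ E ↦ L v) hu
  let e : E ≃ₗ[ℝ] E →L[ℝ] ℝ :=
    (LinearEquiv.ofInjectiveOfFinrankEq A' hA' Subspace.dual_finrank_eq.symm).trans
      LinearMap.toContinuousLinearMap
  exact ⟨e.toContinuousLinearEquiv, by ext; rfl⟩

namespace IsMetricAt

theorem eventually [CompleteSpace E] (hG : IsMetricAt G y) : ∀ᶠ z in 𝓝 y, IsMetricAt G z := by
  have h1 : ∀ᶠ z in 𝓝 y, (G z).IsInvertible :=
    hG.contDiffAt.continuousAt.preimage_mem_nhds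
      (ContinuousLinearEquiv.isOpen.mem_nhds hG.isInvertible)
  filter_upwards [hG.contDiffAt.eventually (by simp), hG.eventually_symm.eventually_nhds, h1]
    with z h2 h3 h4 using ⟨h2, h3, h4⟩

theorem symm (hG : IsMetricAt G y) (u v : E) : G y u v = G y v u :=
  hG.eventually_symm.self_of_nhds u v

theorem differentiableAt (hG : IsMetricAt G y) : DifferentiableAt ℝ G y :=
  hG.contDiffAt.differentiableAt (by simp)

theorem fderiv_symm (hG : IsMetricAt G y) (u v w : E) :
    fderiv ℝ G y u v w = fderiv ℝ G y u w v := by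
  rw [← fderiv_clm_apply_apply hG.differentiableAt, ← fderiv_clm_apply_apply hG.differentiableAt]
  congr 1
  exact EventuallyEq.fderiv_eq (hG.eventually_symm.mono fun z hz ↦ hz v w)

/-- The Christoffel symbols of the second kind are those of the first kind with an index raised. -/
theorem apply_christoffel (hG : IsMetricAt G y) (u v w : E) :
    G y (christoffel G y u v) w = christoffelFirst G y u v w := by
  rw [christoffel_apply, hG.isInvertible.self_apply_inverse]

theorem christoffel_eq (hG : IsMetricAt G y) {u v x : E}
    (h : ∀ w, G y x w = christoffelFirst G y u v w) : christoffel G y u v = x := by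
  rw [christoffel_apply, hG.isInvertible.inverse_apply_eq]
  exact ContinuousLinearMap.ext fun w ↦ (h w).symm

theorem christoffel_symm (hG : IsMetricAt G y) (u v : E) :
    christoffel G y u v = christoffel G y v u :=
  hG.christoffel_eq fun w ↦ by
    rw [hG.apply_christoffel, christoffelFirst_apply, christoffelFirst_apply,
      hG.fderiv_symm w u v]
    ring

/-- The Levi-Civita connection is compatible with the metric. -/
theorem fderiv_apply (hG : IsMetricAt G y) (u v w : E) :
    fderiv ℝ G y u v w = G y (christoffel G y u v) w + G y v (christoffel G y u w) := by
  rw [hG.symm v, hG.apply_christoffel, hG.apply_christoffel, christoffelFirst_apply,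
    christoffelFirst_apply, hG.fderiv_symm u w v, hG.fderiv_symm v u w, hG.fderiv_symm w u v]
  ring

theorem contDiffAt_inverse [CompleteSpace E] (hG : IsMetricAt G y) :
    ContDiffAt ℝ 2 (fun z ↦ (G z).inverse) y :=
  hG.isInvertible.contDiffAt_map_inverse.comp y hG.contDiffAt

theorem differentiableAt_christoffelFirst (hG : IsMetricAt G y) :
    DifferentiableAt ℝ (christoffelFirst G) y := by
  have hD : DifferentiableAt ℝ (fderiv ℝ G) y :=
    (hG.contDiffAt.fderiv_right (m := 1) (by norm_num)).differentiableAt (by simp)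
  let Φ := (ContinuousLinearMap.flipₗᵢ ℝ E E (E →L[ℝ] ℝ)).toContinuousLinearEquiv
  have hF : DifferentiableAt ℝ (fun z ↦ (fderiv ℝ G z).flip) y :=
    Φ.differentiableAt.comp y hD
  have hS := (differentiableAt_const
    (c := (ContinuousLinearMap.flipₗᵢ ℝ E E ℝ).toContinuousLinearEquiv.toContinuousLinearMap)
    (x := y)).clm_comp hF
  exact ((hD.add hF).sub hS).const_smul (1 / 2 : ℝ)

theorem differentiableAt_christoffel [CompleteSpace E] (hG : IsMetricAt G y) :
    DifferentiableAt ℝ (christoffel G) y := by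
  have h1 : DifferentiableAt ℝ (fun z ↦ (G z).inverse) y :=
    hG.contDiffAt_inverse.differentiableAt (by simp)
  exact ((ContinuousLinearMap.compL ℝ E (E →L[ℝ] ℝ) E).differentiableAt.comp y h1).clm_comp
    hG.differentiableAt_christoffelFirst

theorem apply_coordGradient (hG : IsMetricAt G y) (φ : E → ℝ) (v : E) :
    G y (coordGradient G φ y) v = fderiv ℝ φ y v := by
  rw [coordGradient, hG.isInvertible.self_apply_inverse]

theorem apply_hessianOperator (hG : IsMetricAt G y) (φ : E → ℝ) (u v : E) :
    G y (hessianOperator G φ y u) v = coordHessian G φ y u v := by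
  rw [hessianOperator, ContinuousLinearMap.comp_apply, hG.isInvertible.self_apply_inverse]

theorem coordHessian_symm (hG : IsMetricAt G y) (hφ : ContDiffAt ℝ 2 φ y) (u v : E) :
    coordHessian G φ y u v = coordHessian G φ y v u := by
  rw [coordHessian_apply, coordHessian_apply, hG.christoffel_symm u v,
    (hφ.isSymmSndFDerivAt (by simp)).eq u v]

theorem differentiableAt_coordGradient [CompleteSpace E] (hG : IsMetricAt G y)
    (hφ : ContDiffAt ℝ 2 φ y) : DifferentiableAt ℝ (coordGradient G φ) y :=
  (hG.contDiffAt_inverse.differentiableAt (by simp)).clm_apply (differentiableAt_fderiv hφ)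

/-- `hessianOperator` is the covariant derivative of the gradient: `D_u grad φ = ∇_u grad φ -
Γ(u, grad φ)`. -/
theorem fderiv_coordGradient [CompleteSpace E] (hG : IsMetricAt G y) (hφ : ContDiffAt ℝ 2 φ y)
    (u : E) :
    fderiv ℝ (coordGradient G φ) y u =
      hessianOperator G φ y u - christoffel G y u (coordGradient G φ y) := by
  refine hG.isInvertible.injective (ContinuousLinearMap.ext fun w ↦ ?_)
  -- Differentiate the identity `G (grad φ, w) = dφ(w)`, which holds near `y`.
  have h1 : (fun z ↦ G z (coordGradient G φ z) w) =ᶠ[𝓝 y] fun z ↦ fderiv ℝ φ z w :=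
    hG.eventually.mono fun z hz ↦ hz.apply_coordGradient φ w
  have h2 : HasFDerivAt (fun z ↦ G z (coordGradient G φ z) w) _ y :=
    (hG.differentiableAt.hasFDerivAt.clm_apply
      (hG.differentiableAt_coordGradient hφ).hasFDerivAt).clm_apply (hasFDerivAt_const w y)
  have h3 : fderiv ℝ (fun z ↦ G z (coordGradient G φ z) w) y u =
      G y (fderiv ℝ (coordGradient G φ) y u) w + fderiv ℝ G y u (coordGradient G φ y) w := by
    rw [h2.fderiv]
    simp
  rw [h1.fderiv_eq, fderiv_clm_apply_const (differentiableAt_fderiv hφ), hG.fderiv_apply,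
    hG.apply_coordGradient] at h3
  rw [map_sub, sub_apply, hG.apply_hessianOperator, coordHessian_apply]
  linarith

end IsMetricAt

end CoordinateMetric

/-! ### Conformal changes of a metric -/

section Conformal

open Filter Topology

variable {E : Type*} [NormedAddCommGroup E] [NormedSpace ℝ E]

/-- The metric `e^{2φ} G`, conformal to `G`. -/
noncomputable def conformalChange (φ : E → ℝ) (G : E → E →L[ℝ] E →L[ℝ] ℝ) (y : E) :
    E →L[ℝ] E →L[ℝ] ℝ :=
  Real.exp (2 * φ y) • G y

variable {G : E → E →L[ℝ] E →L[ℝ] ℝ} {φ : E → ℝ} {y : E}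

theorem inverse_smul_apply {r : ℝ} (hr : r ≠ 0) {A : E →L[ℝ] E →L[ℝ] ℝ} (hA : A.IsInvertible)
    (ξ : E →L[ℝ] ℝ) : (r • A).inverse ξ = r⁻¹ • A.inverse ξ := by
  have h : (r • A).inverse = r⁻¹ • A.inverse := by
    refine ContinuousLinearMap.inverse_eq ?_ ?_
    · rw [ContinuousLinearMap.smul_comp, ContinuousLinearMap.comp_smul, smul_smul,
        mul_inv_cancel₀ hr, one_smul, hA.self_comp_inverse]
    · rw [ContinuousLinearMap.smul_comp, ContinuousLinearMap.comp_smul, smul_smul,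
        inv_mul_cancel₀ hr, one_smul, hA.inverse_comp_self]
  rw [h, smul_apply]

theorem isInvertible_smul {r : ℝ} (hr : r ≠ 0) {A : E →L[ℝ] E →L[ℝ] ℝ} (hA : A.IsInvertible) :
    (r • A).IsInvertible := by
  refine ContinuousLinearMap.IsInvertible.of_inverse (g := r⁻¹ • A.inverse) ?_ ?_
  · rw [ContinuousLinearMap.smul_comp, ContinuousLinearMap.comp_smul, smul_smul,
      mul_inv_cancel₀ hr, one_smul, hA.self_comp_inverse]
  · rw [ContinuousLinearMap.smul_comp, ContinuousLinearMap.comp_smul, smul_smul,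
      inv_mul_cancel₀ hr, one_smul, hA.inverse_comp_self]

namespace IsMetricAt

theorem conformalChange (hG : IsMetricAt G y) (hφ : ContDiffAt ℝ 2 φ y) :
    IsMetricAt (conformalChange φ G) y where
  contDiffAt := (contDiffAt_const.mul hφ).exp.smul hG.contDiffAt
  eventually_symm := hG.eventually_symm.mono fun z hz u v ↦
    congrArg (Real.exp (2 * φ z) * ·) (hz u v)
  isInvertible := isInvertible_smul (Real.exp_pos _).ne' hG.isInvertible

theorem fderiv_conformalChange (hG : IsMetricAt G y) (hφ : DifferentiableAt ℝ φ y) (u v w : E) :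
    fderiv ℝ (_root_.conformalChange φ G) y u v w =
      Real.exp (2 * φ y) * (fderiv ℝ G y u v w + 2 * fderiv ℝ φ y u * G y v w) := by
  have h := (hφ.hasFDerivAt.const_mul 2).exp.smul hG.differentiableAt.hasFDerivAt
  have h' : fderiv ℝ (_root_.conformalChange φ G) y = _ := h.fderiv
  rw [h']
  simp
  ring

/-- The Christoffel symbols of `e^{2φ} G`. -/
theorem christoffel_conformalChange (hG : IsMetricAt G y) (hφ : ContDiffAt ℝ 2 φ y) (u v : E) :
    christoffel (_root_.conformalChange φ G) y u v =
      christoffel G y u v + (fderiv ℝ φ y u • v + fderiv ℝ φ y v • u -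
        G y u v • coordGradient G φ y) := by
  refine (hG.conformalChange hφ).christoffel_eq fun w ↦ ?_
  have hφ' : DifferentiableAt ℝ φ y := hφ.differentiableAt (by simp)
  rw [christoffelFirst_apply, hG.fderiv_conformalChange hφ', hG.fderiv_conformalChange hφ',
    hG.fderiv_conformalChange hφ']
  have h1 := hG.apply_christoffel u v w
  rw [christoffelFirst_apply] at h1
  simp only [_root_.conformalChange, map_add, map_sub, map_smul, smul_apply, add_apply, sub_apply,
    smul_eq_mul, hG.apply_coordGradient, h1]
  ring

theorem coordGradient_conformalChange (hG : IsMetricAt G y) (f : E → ℝ) :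
    coordGradient (_root_.conformalChange φ G) f y =
      (Real.exp (2 * φ y))⁻¹ • coordGradient G f y :=
  inverse_smul_apply (Real.exp_pos _).ne' hG.isInvertible _

theorem coordHessian_conformalChange (hG : IsMetricAt G y) (hφ : ContDiffAt ℝ 2 φ y)
    (f : E → ℝ) (u v : E) :
    coordHessian (_root_.conformalChange φ G) f y u v =
      coordHessian G f y u v - fderiv ℝ φ y u * fderiv ℝ f y v - fderiv ℝ φ y v * fderiv ℝ f y u +
        G y u v * fderiv ℝ f y (coordGradient G φ y) := by
  rw [coordHessian_apply, coordHessian_apply, hG.christoffel_conformalChange hφ]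
  simp only [map_add, map_sub, map_smul, smul_eq_mul]
  ring

theorem fderiv_coordGradient_comm (hG : IsMetricAt G y) (φ f : E → ℝ) :
    fderiv ℝ f y (coordGradient G φ y) = fderiv ℝ φ y (coordGradient G f y) := by
  rw [← hG.apply_coordGradient f, ← hG.apply_coordGradient φ, hG.symm]

theorem hessianOperator_conformalChange (hG : IsMetricAt G y) (hφ : ContDiffAt ℝ 2 φ y)
    (f : E → ℝ) (u : E) :
    hessianOperator (_root_.conformalChange φ G) f y u =
      (Real.exp (2 * φ y))⁻¹ • (hessianOperator G f y u - fderiv ℝ φ y u • coordGradient G f y -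
        fderiv ℝ f y u • coordGradient G φ y + fderiv ℝ f y (coordGradient G φ y) • u) := by
  refine (hG.conformalChange hφ).isInvertible.injective (ContinuousLinearMap.ext fun w ↦ ?_)
  rw [(hG.conformalChange hφ).apply_hessianOperator, hG.coordHessian_conformalChange hφ]
  have h := (Real.exp_pos (2 * φ y)).ne'
  simp only [_root_.conformalChange, map_add, map_sub, map_smul, smul_apply, add_apply, sub_apply,
    smul_eq_mul, hG.apply_coordGradient, hG.apply_hessianOperator]
  field_simp

theorem coordLaplacian_conformalChange [FiniteDimensional ℝ E] (hG : IsMetricAt G y)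
    (hφ : ContDiffAt ℝ 2 φ y) (f : E → ℝ) :
    coordLaplacian (_root_.conformalChange φ G) f y =
      (Real.exp (2 * φ y))⁻¹ * (coordLaplacian G f y +
        (Module.finrank ℝ E - 2) * fderiv ℝ f y (coordGradient G φ y)) := by
  have h : (hessianOperator (_root_.conformalChange φ G) f y : E →ₗ[ℝ] E) =
      (Real.exp (2 * φ y))⁻¹ • ((hessianOperator G f y : E →ₗ[ℝ] E) -
        (fderiv ℝ φ y : E →ₗ[ℝ] ℝ).smulRight (coordGradient G f y) -
        (fderiv ℝ f y : E →ₗ[ℝ] ℝ).smulRight (coordGradient G φ y) +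
        fderiv ℝ f y (coordGradient G φ y) • LinearMap.id) :=
    LinearMap.ext fun u ↦ hG.hessianOperator_conformalChange hφ f u
  rw [← trace_hessianOperator, h]
  simp only [map_add, map_sub, map_smul, LinearMap.trace_smulRight, LinearMap.trace_id,
    trace_hessianOperator, smul_eq_mul, ContinuousLinearMap.coe_coe,
    hG.fderiv_coordGradient_comm f φ]
  ring

/-- The derivative of the difference `S(v, w) = dφ(v) w + dφ(w) v - G(v, w) grad φ` between the
Christoffel symbols of `e^{2φ} G` and those of `G`. -/
theorem fderiv_christoffel_conformalChange [CompleteSpace E] (hG : IsMetricAt G y)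
    (hφ : ContDiffAt ℝ 2 φ y) (u v w : E) :
    fderiv ℝ (christoffel (_root_.conformalChange φ G)) y u v w =
      fderiv ℝ (christoffel G) y u v w + (fderiv ℝ (fderiv ℝ φ) y u v • w +
        fderiv ℝ (fderiv ℝ φ) y u w • v -
        (G y v w • fderiv ℝ (coordGradient G φ) y u +
          fderiv ℝ G y u v w • coordGradient G φ y)) := by
  have hΓ := hG.differentiableAt_christoffel
  have hdφ := differentiableAt_fderiv hφ
  have h1 : (fun z ↦ christoffel (_root_.conformalChange φ G) z v w) =ᶠ[𝓝 y] fun z ↦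
      christoffel G z v w + (fderiv ℝ φ z v • w + fderiv ℝ φ z w • v -
        G z v w • coordGradient G φ z) := by
    filter_upwards [hG.eventually, hφ.eventually (by simp)] with z h2 h3
      using h2.christoffel_conformalChange h3 v w
  have h2 : HasFDerivAt (fun z ↦
      christoffel G z v w + (fderiv ℝ φ z v • w + fderiv ℝ φ z w • v -
        G z v w • coordGradient G φ z)) _ y :=
    (((hΓ.clm_apply (differentiableAt_const v)).clm_apply
      (differentiableAt_const w)).hasFDerivAt).add
      ((((hdφ.clm_apply (differentiableAt_const v)).hasFDerivAt.smul_const w).add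
      ((hdφ.clm_apply (differentiableAt_const w)).hasFDerivAt.smul_const v)).sub
      (((hG.differentiableAt.clm_apply (differentiableAt_const v)).clm_apply
      (differentiableAt_const w)).hasFDerivAt.smul
      (hG.differentiableAt_coordGradient hφ).hasFDerivAt))
  rw [← fderiv_clm_apply_apply (hG.conformalChange hφ).differentiableAt_christoffel,
    h1.fderiv_eq, h2.fderiv]
  simp only [add_apply, sub_apply, smul_apply, ContinuousLinearMap.smulRight_apply,
    fderiv_clm_apply_apply hΓ, fderiv_clm_apply_const hdφ,
    fderiv_clm_apply_apply hG.differentiableAt]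

/-- The curvature of `e^{2φ} G`.  Since the Levi-Civita connection of `G` is compatible with `G`, the
Christoffel symbols of `G` cancel, apart from those in the Hessian and the curvature of `G`. -/
theorem coordCurvature_conformalChange [CompleteSpace E] (hG : IsMetricAt G y)
    (hφ : ContDiffAt ℝ 2 φ y) (u v w : E) :
    coordCurvature (_root_.conformalChange φ G) y v w u =
      coordCurvature G y v w u +
        (coordHessian G φ y u w - fderiv ℝ φ y u * fderiv ℝ φ y w +
          fderiv ℝ φ y (coordGradient G φ y) * G y u w) • v -
        (coordHessian G φ y v w - fderiv ℝ φ y v * fderiv ℝ φ y w +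
          fderiv ℝ φ y (coordGradient G φ y) * G y v w) • u -
        G y v w • (hessianOperator G φ y u - fderiv ℝ φ y u • coordGradient G φ y) +
        G y u w • (hessianOperator G φ y v - fderiv ℝ φ y v • coordGradient G φ y) := by
  rw [coordCurvature_apply, coordCurvature_apply,
    hG.fderiv_christoffel_conformalChange hφ, hG.fderiv_christoffel_conformalChange hφ]
  simp only [hG.christoffel_conformalChange hφ, hG.fderiv_coordGradient hφ, hG.fderiv_apply,
    coordHessian_apply, map_add, map_sub, map_smul, smul_eq_mul,
    hG.apply_coordGradient, hG.symm _ (coordGradient G φ y)]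
  rw [hG.christoffel_symm v u, (hφ.isSymmSndFDerivAt (by simp)).eq v u,
    hG.symm v u, hG.symm u (christoffel G y v w), hG.symm v (christoffel G y u w)]
  module

/-- The Ricci tensor of `e^{2φ} G`, where `n` is the dimension:
`Ric - (n - 2) (∇dφ - dφ ⊗ dφ) - (Δφ + (n - 2) |dφ|²) G`. -/
theorem coordRicci_conformalChange [FiniteDimensional ℝ E] (hG : IsMetricAt G y)
    (hφ : ContDiffAt ℝ 2 φ y) (v w : E) :
    coordRicci (_root_.conformalChange φ G) y v w =
      coordRicci G y v w -
        (Module.finrank ℝ E - 2) * (coordHessian G φ y v w - fderiv ℝ φ y v * fderiv ℝ φ y w) -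
        (coordLaplacian G φ y +
          (Module.finrank ℝ E - 2) * fderiv ℝ φ y (coordGradient G φ y)) * G y v w := by
  have := FiniteDimensional.complete ℝ E
  -- The coefficient of `v` in `coordCurvature_conformalChange`, as a linear form in `u`.
  let a : E →ₗ[ℝ] ℝ := (coordHessian G φ y w : E →ₗ[ℝ] ℝ) -
    fderiv ℝ φ y w • (fderiv ℝ φ y : E →ₗ[ℝ] ℝ) +
    fderiv ℝ φ y (coordGradient G φ y) • (G y w : E →ₗ[ℝ] ℝ)
  have h : (coordCurvature (_root_.conformalChange φ G) y v w : E →ₗ[ℝ] E) =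
      (coordCurvature G y v w : E →ₗ[ℝ] E) + a.smulRight v -
        (coordHessian G φ y v w - fderiv ℝ φ y v * fderiv ℝ φ y w +
          fderiv ℝ φ y (coordGradient G φ y) * G y v w) • LinearMap.id -
        G y v w • ((hessianOperator G φ y : E →ₗ[ℝ] E) -
          (fderiv ℝ φ y : E →ₗ[ℝ] ℝ).smulRight (coordGradient G φ y)) +
        (G y w : E →ₗ[ℝ] ℝ).smulRight
          (hessianOperator G φ y v - fderiv ℝ φ y v • coordGradient G φ y) := by
    refine LinearMap.ext fun u ↦ ?_
    refine (hG.coordCurvature_conformalChange hφ u v w).trans ?_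
    simp [a, hG.coordHessian_symm hφ u w, hG.symm u w, mul_comm]
  rw [← trace_coordCurvature, h]
  simp only [map_add, map_sub, map_smul, LinearMap.trace_smulRight, LinearMap.trace_id,
    trace_hessianOperator, smul_eq_mul, ContinuousLinearMap.coe_coe, trace_coordCurvature]
  simp only [a, LinearMap.add_apply, LinearMap.sub_apply, LinearMap.smul_apply, smul_eq_mul,
    ContinuousLinearMap.coe_coe, hG.symm w, hG.apply_hessianOperator, hG.apply_coordGradient,
    hG.coordHessian_symm hφ w v]
  ring

end IsMetricAt

end Conformal

/-! ### Elementary properties of the Ricci tensor in coordinates -/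

section RicciTensor

open Filter Topology

variable {E : Type*} [NormedAddCommGroup E] [NormedSpace ℝ E]
  {G G' : E → E →L[ℝ] E →L[ℝ] ℝ} {y : E}

theorem christoffel_congr (h : G =ᶠ[𝓝 y] G') : christoffel G =ᶠ[𝓝 y] christoffel G' := by
  filter_upwards [h, h.fderiv (𝕜 := ℝ)] with z h1 h2
  rw [christoffel, christoffel, christoffelFirst, christoffelFirst, h1, h2]

/-- The Ricci tensor at `y` depends only on the germ of the metric at `y`. -/
theorem coordRicci_congr (h : G =ᶠ[𝓝 y] G') (v w : E) :
    coordRicci G y v w = coordRicci G' y v w := by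
  have h1 := christoffel_congr h
  rw [coordRicci, coordRicci, coordCurvature, coordCurvature, h1.fderiv_eq, h1.eq_of_nhds]

theorem coordRicci_zero_left (G : E → E →L[ℝ] E →L[ℝ] ℝ) (y w : E) : coordRicci G y 0 w = 0 := by
  have h : coordCurvature G y 0 w = 0 := by
    ext u
    simp [coordCurvature_apply]
  rw [coordRicci, h]
  simp

theorem coordRicci_zero_right (G : E → E →L[ℝ] E →L[ℝ] ℝ) (y v : E) : coordRicci G y v 0 = 0 := by
  have h : coordCurvature G y v 0 = 0 := by
    ext u
    simp [coordCurvature_apply]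
  rw [coordRicci, h]
  simp

end RicciTensor

/-! ### Product metrics -/

section Product

open Filter Topology

variable {E : Type*} [NormedAddCommGroup E] [NormedSpace ℝ E]
  {E' : Type*} [NormedAddCommGroup E'] [NormedSpace ℝ E']

/-- The product metric `G₁ + G₂` on `E × E'`. -/
noncomputable def prodMetric (G₁ : E → E →L[ℝ] E →L[ℝ] ℝ) (G₂ : E' → E' →L[ℝ] E' →L[ℝ] ℝ)
    (z : E × E') : E × E' →L[ℝ] E × E' →L[ℝ] ℝ :=
  (G₁ z.1).bilinearComp (.fst ℝ E E') (.fst ℝ E E') +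
    (G₂ z.2).bilinearComp (.snd ℝ E E') (.snd ℝ E E')

variable {G₁ : E → E →L[ℝ] E →L[ℝ] ℝ} {G₂ : E' → E' →L[ℝ] E' →L[ℝ] ℝ} {σ : E → ℝ} {y : E × E'}

theorem prodMetric_apply (z u v : E × E') :
    prodMetric G₁ G₂ z u v = G₁ z.1 u.1 v.1 + G₂ z.2 u.2 v.2 := rfl

theorem fderiv_comp_fst {X : Type*} [NormedAddCommGroup X] [NormedSpace ℝ X] {A : E → X}
    (hA : DifferentiableAt ℝ A y.1) (u : E × E') :
    fderiv ℝ (fun z : E × E' ↦ A z.1) y u = fderiv ℝ A y.1 u.1 := by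
  have h := hA.hasFDerivAt.comp y (hasFDerivAt_fst (p := y) (𝕜 := ℝ))
  have h' : fderiv ℝ (fun z : E × E' ↦ A z.1) y = _ := h.fderiv
  rw [h']
  rfl

theorem fderiv_comp_snd {X : Type*} [NormedAddCommGroup X] [NormedSpace ℝ X] {A : E' → X}
    (hA : DifferentiableAt ℝ A y.2) (u : E × E') :
    fderiv ℝ (fun z : E × E' ↦ A z.2) y u = fderiv ℝ A y.2 u.2 := by
  have h := hA.hasFDerivAt.comp y (hasFDerivAt_snd (p := y) (𝕜 := ℝ))
  have h' : fderiv ℝ (fun z : E × E' ↦ A z.2) y = _ := h.fderiv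
  rw [h']
  rfl

namespace IsMetricAt

theorem prodMetric (h₁ : IsMetricAt G₁ y.1) (h₂ : IsMetricAt G₂ y.2) :
    IsMetricAt (prodMetric G₁ G₂) y where
  contDiffAt := by
    let P₁ : (E →L[ℝ] E →L[ℝ] ℝ) →L[ℝ] (E × E' →L[ℝ] E × E' →L[ℝ] ℝ) :=
      (ContinuousLinearMap.precomp (E × E' →L[ℝ] ℝ) (ContinuousLinearMap.fst ℝ E E')) ∘L
        (ContinuousLinearMap.compL ℝ E (E →L[ℝ] ℝ) (E × E' →L[ℝ] ℝ)
          (ContinuousLinearMap.precomp ℝ (ContinuousLinearMap.fst ℝ E E')))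
    let P₂ : (E' →L[ℝ] E' →L[ℝ] ℝ) →L[ℝ] (E × E' →L[ℝ] E × E' →L[ℝ] ℝ) :=
      (ContinuousLinearMap.precomp (E × E' →L[ℝ] ℝ) (ContinuousLinearMap.snd ℝ E E')) ∘L
        (ContinuousLinearMap.compL ℝ E' (E' →L[ℝ] ℝ) (E × E' →L[ℝ] ℝ)
          (ContinuousLinearMap.precomp ℝ (ContinuousLinearMap.snd ℝ E E')))
    exact (P₁.contDiff.contDiffAt.comp y (h₁.contDiffAt.comp y contDiffAt_fst)).add
      (P₂.contDiff.contDiffAt.comp y (h₂.contDiffAt.comp y contDiffAt_snd))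
  eventually_symm := by
    filter_upwards [continuous_fst.continuousAt.eventually h₁.eventually_symm,
      continuous_snd.continuousAt.eventually h₂.eventually_symm] with z h3 h4 u v
    rw [prodMetric_apply, prodMetric_apply, h3, h4]
  isInvertible := by
    refine ContinuousLinearMap.IsInvertible.of_inverse
      (g := ((G₁ y.1).inverse ∘L ContinuousLinearMap.precomp ℝ (.inl ℝ E E')).prod
        ((G₂ y.2).inverse ∘L ContinuousLinearMap.precomp ℝ (.inr ℝ E E'))) ?_ ?_
    · refine ContinuousLinearMap.ext fun ξ ↦ ContinuousLinearMap.ext fun w ↦ ?_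
      refine (congrArg₂ (· + ·)
        (congrArg (· w.1) (h₁.isInvertible.self_apply_inverse (ξ ∘L .inl ℝ E E')))
        (congrArg (· w.2) (h₂.isInvertible.self_apply_inverse (ξ ∘L .inr ℝ E E')))).trans ?_
      simp [← map_add]
    · refine ContinuousLinearMap.ext fun u ↦ Prod.ext ?_ ?_
      · refine h₁.isInvertible.inverse_apply_eq.2 (ContinuousLinearMap.ext fun w ↦ ?_)
        simp [prodMetric_apply]
      · refine h₂.isInvertible.inverse_apply_eq.2 (ContinuousLinearMap.ext fun w ↦ ?_)
        simp [prodMetric_apply]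

theorem fderiv_prodMetric (h₁ : IsMetricAt G₁ y.1) (h₂ : IsMetricAt G₂ y.2) (u v w : E × E') :
    fderiv ℝ (_root_.prodMetric G₁ G₂) y u v w =
      fderiv ℝ G₁ y.1 u.1 v.1 w.1 + fderiv ℝ G₂ y.2 u.2 v.2 w.2 := by
  have d₁ : DifferentiableAt ℝ (fun z ↦ G₁ z v.1 w.1) y.1 :=
    (h₁.differentiableAt.clm_apply (differentiableAt_const _)).clm_apply (differentiableAt_const _)
  have d₂ : DifferentiableAt ℝ (fun z ↦ G₂ z v.2 w.2) y.2 :=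
    (h₂.differentiableAt.clm_apply (differentiableAt_const _)).clm_apply (differentiableAt_const _)
  have h : fderiv ℝ (fun z ↦ _root_.prodMetric G₁ G₂ z v w) y =
      fderiv ℝ (fun z : E × E' ↦ G₁ z.1 v.1 w.1) y + fderiv ℝ (fun z : E × E' ↦ G₂ z.2 v.2 w.2) y :=
    fderiv_add (d₁.comp y differentiableAt_fst) (d₂.comp y differentiableAt_snd)
  rw [← fderiv_clm_apply_apply (h₁.prodMetric h₂).differentiableAt, h, add_apply,
    fderiv_comp_fst (A := fun z ↦ G₁ z v.1 w.1) d₁, fderiv_comp_snd (A := fun z ↦ G₂ z v.2 w.2) d₂,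
    fderiv_clm_apply_apply h₁.differentiableAt, fderiv_clm_apply_apply h₂.differentiableAt]

theorem christoffel_prodMetric (h₁ : IsMetricAt G₁ y.1) (h₂ : IsMetricAt G₂ y.2)
    (u v : E × E') :
    christoffel (_root_.prodMetric G₁ G₂) y u v =
      (christoffel G₁ y.1 u.1 v.1, christoffel G₂ y.2 u.2 v.2) := by
  refine (h₁.prodMetric h₂).christoffel_eq fun w ↦ ?_
  rw [prodMetric_apply, h₁.apply_christoffel, h₂.apply_christoffel]
  simp only [christoffelFirst_apply, h₁.fderiv_prodMetric h₂]
  ring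

theorem fderiv_christoffel_prodMetric [CompleteSpace E] [CompleteSpace E']
    (h₁ : IsMetricAt G₁ y.1) (h₂ : IsMetricAt G₂ y.2) (u v w : E × E') :
    fderiv ℝ (christoffel (_root_.prodMetric G₁ G₂)) y u v w =
      (fderiv ℝ (christoffel G₁) y.1 u.1 v.1 w.1, fderiv ℝ (christoffel G₂) y.2 u.2 v.2 w.2) := by
  have d₁ : DifferentiableAt ℝ (fun z ↦ christoffel G₁ z v.1 w.1) y.1 :=
    (h₁.differentiableAt_christoffel.clm_apply (differentiableAt_const _)).clm_apply
      (differentiableAt_const _)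
  have d₂ : DifferentiableAt ℝ (fun z ↦ christoffel G₂ z v.2 w.2) y.2 :=
    (h₂.differentiableAt_christoffel.clm_apply (differentiableAt_const _)).clm_apply
      (differentiableAt_const _)
  have h3 : (fun z ↦ christoffel (_root_.prodMetric G₁ G₂) z v w) =ᶠ[𝓝 y] fun z ↦
      (christoffel G₁ z.1 v.1 w.1, christoffel G₂ z.2 v.2 w.2) := by
    filter_upwards [continuous_fst.continuousAt.eventually h₁.eventually,
      continuous_snd.continuousAt.eventually h₂.eventually] with z h4 h5
      using h4.christoffel_prodMetric h5 v w
  have h4 := (d₁.comp y differentiableAt_fst).fderiv_prodMk (d₂.comp y differentiableAt_snd)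
  rw [← fderiv_clm_apply_apply (h₁.prodMetric h₂).differentiableAt_christoffel, h3.fderiv_eq]
  refine (congrArg (fun L : E × E' →L[ℝ] E × E' ↦ L u) h4).trans (Prod.ext ?_ ?_)
  · exact (fderiv_comp_fst (A := fun z ↦ christoffel G₁ z v.1 w.1) d₁ u).trans
      (fderiv_clm_apply_apply h₁.differentiableAt_christoffel _ _ _)
  · exact (fderiv_comp_snd (A := fun z ↦ christoffel G₂ z v.2 w.2) d₂ u).trans
      (fderiv_clm_apply_apply h₂.differentiableAt_christoffel _ _ _)

theorem coordRicci_prodMetric [FiniteDimensional ℝ E] [FiniteDimensional ℝ E']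
    (h₁ : IsMetricAt G₁ y.1) (h₂ : IsMetricAt G₂ y.2) (v w : E × E') :
    coordRicci (_root_.prodMetric G₁ G₂) y v w =
      coordRicci G₁ y.1 v.1 w.1 + coordRicci G₂ y.2 v.2 w.2 := by
  have := FiniteDimensional.complete ℝ E
  have := FiniteDimensional.complete ℝ E'
  rw [coordRicci, coordRicci, coordRicci, ← LinearMap.trace_prodMap']
  congr 1
  refine LinearMap.ext fun u ↦ ?_
  refine (coordCurvature_apply _ y u v w).trans ?_
  simp only [h₁.fderiv_christoffel_prodMetric h₂, h₁.christoffel_prodMetric h₂]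
  rfl

theorem coordHessian_prodMetric_comp_fst (h₁ : IsMetricAt G₁ y.1) (h₂ : IsMetricAt G₂ y.2)
    (hσ : ContDiffAt ℝ 2 σ y.1) (u v : E × E') :
    coordHessian (_root_.prodMetric G₁ G₂) (fun z ↦ σ z.1) y u v =
      coordHessian G₁ σ y.1 u.1 v.1 := by
  have h3 : (fun z ↦ fderiv ℝ (fun z : E × E' ↦ σ z.1) z v) =ᶠ[𝓝 y]
      fun z ↦ fderiv ℝ σ z.1 v.1 := by
    filter_upwards [continuous_fst.continuousAt.eventually (hσ.eventually (by simp))] with z h4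
      using fderiv_comp_fst (h4.differentiableAt (by simp)) v
  have hσ' : ContDiffAt ℝ 2 (fun z : E × E' ↦ σ z.1) y := hσ.comp y contDiffAt_fst
  have d : DifferentiableAt ℝ (fun z ↦ fderiv ℝ σ z v.1) y.1 :=
    (differentiableAt_fderiv hσ).clm_apply (differentiableAt_const _)
  rw [coordHessian_apply, coordHessian_apply, h₁.christoffel_prodMetric h₂,
    ← fderiv_clm_apply_const (differentiableAt_fderiv hσ'), h3.fderiv_eq,
    fderiv_comp_fst (A := fun z ↦ fderiv ℝ σ z v.1) d,
    fderiv_clm_apply_const (differentiableAt_fderiv hσ),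
    fderiv_comp_fst (hσ.differentiableAt (by simp))]

theorem coordGradient_prodMetric_comp_fst (h₁ : IsMetricAt G₁ y.1) (h₂ : IsMetricAt G₂ y.2)
    (hσ : ContDiffAt ℝ 2 σ y.1) :
    coordGradient (_root_.prodMetric G₁ G₂) (fun z ↦ σ z.1) y = (coordGradient G₁ σ y.1, 0) := by
  refine (h₁.prodMetric h₂).isInvertible.injective (ContinuousLinearMap.ext fun w ↦ ?_)
  rw [(h₁.prodMetric h₂).apply_coordGradient, prodMetric_apply, h₁.apply_coordGradient,
    fderiv_comp_fst (hσ.differentiableAt (by simp))]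
  simp

theorem coordLaplacian_prodMetric_comp_fst [FiniteDimensional ℝ E] [FiniteDimensional ℝ E']
    (h₁ : IsMetricAt G₁ y.1) (h₂ : IsMetricAt G₂ y.2) (hσ : ContDiffAt ℝ 2 σ y.1) :
    coordLaplacian (_root_.prodMetric G₁ G₂) (fun z ↦ σ z.1) y = coordLaplacian G₁ σ y.1 := by
  have h : (hessianOperator (_root_.prodMetric G₁ G₂) (fun z ↦ σ z.1) y : E × E' →ₗ[ℝ] E × E') =
      LinearMap.prodMap (hessianOperator G₁ σ y.1 : E →ₗ[ℝ] E) (0 : E' →ₗ[ℝ] E') := by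
    refine LinearMap.ext fun u ↦ ?_
    refine (h₁.prodMetric h₂).isInvertible.injective (ContinuousLinearMap.ext fun w ↦ ?_)
    refine ((h₁.prodMetric h₂).apply_hessianOperator _ _ _).trans ?_
    rw [h₁.coordHessian_prodMetric_comp_fst h₂ hσ, prodMetric_apply]
    simp [h₁.apply_hessianOperator]
  rw [← trace_hessianOperator, h, LinearMap.trace_prodMap', trace_hessianOperator, map_zero,
    add_zero]

end IsMetricAt

end Product

/-! ### The Ricci tensor of a base conformal warped product in coordinates -/

section CoordinateWarpedProduct

open Filter Topology

variable {E : Type*} [NormedAddCommGroup E] [NormedSpace ℝ E]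
  {E' : Type*} [NormedAddCommGroup E'] [NormedSpace ℝ E']
  {G : E → E →L[ℝ] E →L[ℝ] ℝ} {G' : E' → E' →L[ℝ] E' →L[ℝ] ℝ} {σ : E → ℝ}

theorem fderiv_exp_const_mul {y : E} (hσ : DifferentiableAt ℝ σ y) (a : ℝ) (u : E) :
    fderiv ℝ (fun z ↦ Real.exp (a * σ z)) y u =
      Real.exp (a * σ y) * (a * fderiv ℝ σ y u) := by
  rw [((hσ.hasFDerivAt.const_mul a).exp).fderiv]
  rfl

theorem fderiv_const_mul_apply {y : E} (hσ : DifferentiableAt ℝ σ y) (a : ℝ) (u : E) :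
    fderiv ℝ (fun z ↦ a * σ z) y u = a * fderiv ℝ σ y u := by
  rw [(hσ.hasFDerivAt.const_mul a).fderiv]
  rfl

theorem coordHessian_exp_const_mul {y : E} (hσ : ContDiffAt ℝ 2 σ y) (a : ℝ) (u v : E) :
    coordHessian G (fun z ↦ Real.exp (a * σ z)) y u v =
      Real.exp (a * σ y) *
        (a * coordHessian G σ y u v + a ^ 2 * (fderiv ℝ σ y u * fderiv ℝ σ y v)) := by
  have hσ₁ : DifferentiableAt ℝ σ y := hσ.differentiableAt (by simp)
  have he : ContDiffAt ℝ 2 (fun z ↦ Real.exp (a * σ z)) y := (contDiffAt_const.mul hσ).exp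
  have h1 : (fun z ↦ fderiv ℝ (fun z ↦ Real.exp (a * σ z)) z v) =ᶠ[𝓝 y]
      fun z ↦ Real.exp (a * σ z) * (a * fderiv ℝ σ z v) :=
    (hσ.eventually (by simp)).mono fun z hz ↦
      fderiv_exp_const_mul (hz.differentiableAt (by simp)) a v
  have d : DifferentiableAt ℝ (fun z ↦ fderiv ℝ σ z v) y :=
    (differentiableAt_fderiv hσ).clm_apply (differentiableAt_const _)
  have h2 := ((hσ₁.hasFDerivAt.const_mul a).exp).mul (d.hasFDerivAt.const_mul a)
  have h3 : fderiv ℝ (fun z ↦ Real.exp (a * σ z) * (a * fderiv ℝ σ z v)) y = _ := h2.fderiv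
  rw [coordHessian_apply, coordHessian_apply,
    ← fderiv_clm_apply_const (differentiableAt_fderiv he), h1.fderiv_eq, h3,
    fderiv_exp_const_mul hσ₁, ← fderiv_clm_apply_const (differentiableAt_fderiv hσ)]
  simp only [add_apply, smul_apply, smul_eq_mul]
  ring

theorem coordHessian_const_mul {y : E} (hσ : ContDiffAt ℝ 2 σ y) (a : ℝ) (u v : E) :
    coordHessian G (fun z ↦ a * σ z) y u v = a * coordHessian G σ y u v := by
  have hσ₁ : DifferentiableAt ℝ σ y := hσ.differentiableAt (by simp)
  have h1 : fderiv ℝ (fun z ↦ a * σ z) =ᶠ[𝓝 y] fun z ↦ a • fderiv ℝ σ z :=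
    (hσ.eventually (by simp)).mono fun z hz ↦
      ((hz.differentiableAt (by simp)).hasFDerivAt.const_mul a).fderiv
  have h2 := (differentiableAt_fderiv hσ).hasFDerivAt.const_smul a
  have h3 : fderiv ℝ (fun z ↦ a • fderiv ℝ σ z) y = _ := h2.fderiv
  rw [coordHessian_apply, coordHessian_apply, h1.fderiv_eq, h3, fderiv_const_mul_apply hσ₁]
  simp only [smul_apply, smul_eq_mul]
  ring

theorem coordGradient_const_mul {y : E} (hσ : DifferentiableAt ℝ σ y) (a : ℝ) :
    coordGradient G (fun z ↦ a * σ z) y = a • coordGradient G σ y := by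
  rw [coordGradient, (hσ.hasFDerivAt.const_mul a).fderiv, map_smul, coordGradient]

theorem coordLaplacian_const_mul {y : E} (hσ : ContDiffAt ℝ 2 σ y) (a : ℝ) :
    coordLaplacian G (fun z ↦ a * σ z) y = a * coordLaplacian G σ y := by
  have h : coordHessian G (fun z ↦ a * σ z) y = a • coordHessian G σ y :=
    ContinuousLinearMap.ext fun u ↦ ContinuousLinearMap.ext fun v ↦
      coordHessian_const_mul hσ a u v
  rw [coordLaplacian, h, ContinuousLinearMap.comp_smul, ContinuousLinearMap.toLinearMap_smul,
    map_smul, coordLaplacian, smul_eq_mul]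

theorem coordLaplacian_exp_const_mul [FiniteDimensional ℝ E] {y : E} (hσ : ContDiffAt ℝ 2 σ y)
    (a : ℝ) :
    coordLaplacian G (fun z ↦ Real.exp (a * σ z)) y =
      Real.exp (a * σ y) *
        (a * coordLaplacian G σ y + a ^ 2 * fderiv ℝ σ y (coordGradient G σ y)) := by
  have h1 : coordHessian G (fun z ↦ Real.exp (a * σ z)) y =
      Real.exp (a * σ y) •
        (a • coordHessian G σ y + a ^ 2 • (fderiv ℝ σ y).smulRight (fderiv ℝ σ y)) :=
    ContinuousLinearMap.ext fun u ↦ ContinuousLinearMap.ext fun v ↦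
      coordHessian_exp_const_mul hσ a u v
  have h2 : (hessianOperator G (fun z ↦ Real.exp (a * σ z)) y : E →ₗ[ℝ] E) =
      Real.exp (a * σ y) • (a • (hessianOperator G σ y : E →ₗ[ℝ] E) +
        a ^ 2 • (fderiv ℝ σ y : E →ₗ[ℝ] ℝ).smulRight (coordGradient G σ y)) := by
    refine LinearMap.ext fun u ↦ ?_
    simp [hessianOperator, h1, coordGradient]
  rw [← trace_hessianOperator, h2]
  simp only [map_add, map_smul, LinearMap.trace_smulRight, trace_hessianOperator, smul_eq_mul,
    ContinuousLinearMap.coe_coe]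

/-- With `ψ = e^σ`, the metric `ψ^{2μ} G + ψ² G'` is `e^{2σ} (e^{2(μ-1)σ} G + G')`, so that its
Ricci tensor results from two conformal changes, separated by a product. -/
theorem coordRicci_warpedProduct [FiniteDimensional ℝ E] [FiniteDimensional ℝ E'] {y : E × E'}
    (h : IsMetricAt G y.1) (h' : IsMetricAt G' y.2) (hσ : ContDiffAt ℝ 2 σ y.1) (μ D Q : ℝ)
    (hD : D = (Module.finrank ℝ E - 2) * μ + Module.finrank ℝ E')
    (hQ : Q = μ * D + Module.finrank ℝ E' * (μ - 1)) (v w : E × E') :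
    coordRicci (conformalChange (fun z : E × E' ↦ σ z.1)
        (prodMetric (conformalChange (fun z ↦ (μ - 1) * σ z) G) G')) y v w =
      coordRicci G y.1 v.1 w.1 + coordRicci G' y.2 v.2 w.2 - D * coordHessian G σ y.1 v.1 w.1 +
        Q * (fderiv ℝ σ y.1 v.1 * fderiv ℝ σ y.1 w.1) -
        (coordLaplacian G σ y.1 + D * fderiv ℝ σ y.1 (coordGradient G σ y.1)) *
          (μ * G y.1 v.1 w.1 + (Real.exp (2 * ((μ - 1) * σ y.1)))⁻¹ * G' y.2 v.2 w.2) := by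
  have hσ₁ : DifferentiableAt ℝ σ y.1 := hσ.differentiableAt (by simp)
  have hσμ : ContDiffAt ℝ 2 (fun z ↦ (μ - 1) * σ z) y.1 := contDiffAt_const.mul hσ
  have hc := h.conformalChange hσμ
  have hσ' : ContDiffAt ℝ 2 (fun z : E × E' ↦ σ z.1) y := hσ.comp y contDiffAt_fst
  rw [(hc.prodMetric h').coordRicci_conformalChange hσ', hc.coordRicci_prodMetric h',
    hc.coordHessian_prodMetric_comp_fst h' hσ, hc.coordLaplacian_prodMetric_comp_fst h' hσ,
    hc.coordGradient_prodMetric_comp_fst h' hσ, prodMetric_apply,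
    h.coordRicci_conformalChange hσμ, h.coordHessian_conformalChange hσμ,
    h.coordLaplacian_conformalChange hσμ, h.coordGradient_conformalChange,
    fderiv_comp_fst hσ₁, fderiv_comp_fst hσ₁, fderiv_comp_fst hσ₁, Module.finrank_prod,
    coordHessian_const_mul hσ, coordLaplacian_const_mul hσ, coordGradient_const_mul hσ₁,
    fderiv_const_mul_apply hσ₁, fderiv_const_mul_apply hσ₁, fderiv_const_mul_apply hσ₁, hQ, hD]
  have hexp := (Real.exp_pos (2 * ((μ - 1) * σ y.1))).ne'
  simp only [conformalChange, smul_apply, smul_eq_mul, map_smul, Nat.cast_add]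
  field_simp
  ring

end CoordinateWarpedProduct

/-! ### Metrics in charts -/

section Charts

open Filter Topology

variable {E : Type*} [NormedAddCommGroup E] [NormedSpace ℝ E]
  {H : Type*} [TopologicalSpace H] {I : ModelWithCorners ℝ E H}
  {M : Type*} [TopologicalSpace M] [ChartedSpace H M] [IsManifold I ∞ M]

/-- Mathlib identifies the tangent space at `x` with `E` through the preferred chart at `x`, so that
the coordinates of a tangent vector at `x` are the vector itself. -/
theorem tangentCoord_eq_id (x : M) :
    (tangentCoord (I := I) x : E →L[ℝ] E) = ContinuousLinearMap.id ℝ E := by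
  have : IsManifold I 1 M := .of_le (n := ∞) (by simp)
  have hx := mem_chart_source H x
  refine ContinuousLinearMap.ext fun v ↦ ?_
  have h := (TangentBundle.continuousLinearMapAt_trivializationAt (I := I) hx).symm.trans
    (TangentBundle.continuousLinearMapAt_trivializationAt_eq_core hx)
  exact (congrArg (fun L : E →L[ℝ] E ↦ L v) h).trans
    ((tangentBundleCore I M).coordChange_self (achart H x) x hx v)

/-- On the target of the chart at `x`, the coordinate frame is the inverse of the trivialization of
the tangent bundle at `x`, in which the smoothness of a metric is expressed. -/
theorem coordFrame_eq_symmL (x : M) {y : E} (hy : y ∈ (extChartAt I x).target) :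
    coordFrame (I := I) x y =
      (trivializationAt E (TangentSpace I) x).symmL ℝ ((extChartAt I x).symm y) := by
  have : IsManifold I 1 M := .of_le (n := ∞) (by simp)
  have hx : (extChartAt I x).symm y ∈ (chartAt H x).source := by
    rw [← extChartAt_source I]
    exact (extChartAt I x).map_target hy
  have h : (mfderivWithin 𝓘(ℝ, E) I (extChartAt I x).symm (Set.range I) y : E →L[ℝ] E) =
      mfderivWithin 𝓘(ℝ, E) I (extChartAt I x).symm (Set.range I)
        (extChartAt I x ((extChartAt I x).symm y)) := by
    rw [(extChartAt I x).right_inv hy]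
  exact h.trans (TangentBundle.symmL_trivializationAt (I := I) hx).symm

theorem coordFrame_eq_id (x : M) :
    (coordFrame (I := I) x (extChartAt I x x) : E →L[ℝ] E) = ContinuousLinearMap.id ℝ E := by
  have : IsManifold I 1 M := .of_le (n := ∞) (by simp)
  have hx := mem_chart_source H x
  refine ContinuousLinearMap.ext fun v ↦ ?_
  have h := (TangentBundle.symmL_trivializationAt (I := I) hx).symm.trans
    (TangentBundle.symmL_trivializationAt_eq_core hx)
  exact (congrArg (fun L : E →L[ℝ] E ↦ L v) h).trans
    ((tangentBundleCore I M).coordChange_self (achart H x) x hx v)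

namespace PseudoRiemannianMetric

theorem inChart_apply (g : PseudoRiemannianMetric I M) (x : M) {y : E}
    (hy : y ∈ (extChartAt I x).target) (u v : E) :
    g.inChart x y u v = g.val ((extChartAt I x).symm y)
      ((trivializationAt E (TangentSpace I) x).symmL ℝ ((extChartAt I x).symm y) u)
      ((trivializationAt E (TangentSpace I) x).symmL ℝ ((extChartAt I x).symm y) v) := by
  rw [← coordFrame_eq_symmL x hy]
  rfl

theorem inChart_self_apply (g : PseudoRiemannianMetric I M) (x : M) (u v : TangentSpace I x) :
    g.inChart x (extChartAt I x x) u v = g.val x u v := by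
  have h1 : g.inChart x (extChartAt I x x) u v =
      (g.val ((extChartAt I x).symm (extChartAt I x x)) : E →L[ℝ] E →L[ℝ] ℝ)
        ((coordFrame (I := I) x (extChartAt I x x) : E →L[ℝ] E) u)
        ((coordFrame (I := I) x (extChartAt I x x) : E →L[ℝ] E) v) := rfl
  have h2 : (g.val ((extChartAt I x).symm (extChartAt I x x)) : E →L[ℝ] E →L[ℝ] ℝ) =
      (g.val x : E →L[ℝ] E →L[ℝ] ℝ) := by
    rw [extChartAt_to_inv]
  rw [h1, h2, coordFrame_eq_id]
  rfl

theorem ricci_eq (g : PseudoRiemannianMetric I M) (x : M) (u v : TangentSpace I x) :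
    g.ricci x u v = coordRicci (g.inChart x) (extChartAt I x x) u v := by
  have h1 : g.ricci x u v = coordRicci (g.inChart x) (extChartAt I x x)
    ((tangentCoord (I := I) x : E →L[ℝ] E) u) ((tangentCoord (I := I) x : E →L[ℝ] E) v) := rfl
  rw [h1, tangentCoord_eq_id]
  rfl

theorem hessian_eq (g : PseudoRiemannianMetric I M) (f : M → ℝ) (x : M) (u v : TangentSpace I x) :
    g.hessian f x u v =
      coordHessian (g.inChart x) (f ∘ (extChartAt I x).symm) (extChartAt I x x) u v := by
  have h1 : g.hessian f x u v =
    coordHessian (g.inChart x) (f ∘ (extChartAt I x).symm) (extChartAt I x x)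
    ((tangentCoord (I := I) x : E →L[ℝ] E) u) ((tangentCoord (I := I) x : E →L[ℝ] E) v) := rfl
  rw [h1, tangentCoord_eq_id]
  rfl

/-- The coordinate expression of a metric is its expression in the trivialization of the tangent
bundle, in which `PseudoRiemannianMetric.contMDiff` is stated. -/
theorem contDiffAt_inChart [I.Boundaryless] (g : PseudoRiemannianMetric I M) (x : M) :
    ContDiffAt ℝ 2 (g.inChart x) (extChartAt I x x) := by
  have h1 := ((contMDiffAt_hom_bundle _).1 (g.contMDiff x)).2
  have h2 : ContMDiffAt 𝓘(ℝ, E) I ∞ (extChartAt I x).symm (extChartAt I x x) :=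
    (contMDiffOn_extChartAt_symm x).contMDiffAt (extChartAt_target_mem_nhds x)
  have h3 := (h1.comp_of_eq h2 (extChartAt_to_inv x)).contDiffAt.of_le
    (WithTop.coe_le_coe.2 (le_top : (2 : ℕ∞) ≤ ⊤))
  refine h3.congr_of_eventuallyEq ?_
  filter_upwards [extChartAt_target_mem_nhds (I := I) x] with y hy
  refine ContinuousLinearMap.ext fun u ↦ ContinuousLinearMap.ext fun v ↦ ?_
  have hx : (extChartAt I x).symm y ∈ (chartAt H x).source := by
    rw [← extChartAt_source I]
    exact (extChartAt I x).map_target hy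
  exact (g.inChart_apply x hy u v).trans (inCoordinates_apply_symmL x _ hx _ u v).symm

theorem isMetricAt_inChart [FiniteDimensional ℝ E] [I.Boundaryless]
    (g : PseudoRiemannianMetric I M) (x : M) :
    IsMetricAt (g.inChart x) (extChartAt I x x) where
  contDiffAt := g.contDiffAt_inChart x
  eventually_symm := Eventually.of_forall fun y u v ↦
    g.symm ((extChartAt I x).symm y) (coordFrame (I := I) x y u) (coordFrame (I := I) x y v)
  isInvertible := by
    refine isInvertible_of_nondegenerate _ fun u hu ↦ ?_
    refine g.nondegenerate x u fun v ↦ ?_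
    rw [← g.inChart_self_apply x u v]
    exact hu v

end PseudoRiemannianMetric

end Charts

/-! ### The product chart -/

section ProductChart

variable {E : Type*} [NormedAddCommGroup E] [NormedSpace ℝ E]
  {H : Type*} [TopologicalSpace H] {I : ModelWithCorners ℝ E H}
  {B : Type*} [TopologicalSpace B] [ChartedSpace H B] [IsManifold I ∞ B]
  {E' : Type*} [NormedAddCommGroup E'] [NormedSpace ℝ E']
  {H' : Type*} [TopologicalSpace H'] {J : ModelWithCorners ℝ E' H'}
  {F : Type*} [TopologicalSpace F] [ChartedSpace H' F] [IsManifold J ∞ F]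

/-- The chart of `B × F` at `p` is the product of the charts at `p.1` and `p.2`, so that the metric
`c² g_B + w² g_F` has the same form in coordinates. -/
theorem inChart_bcwp_apply (gB : PseudoRiemannianMetric I B) (gF : PseudoRiemannianMetric J F)
    (c w : B → ℝ) (hc : ContMDiff I 𝓘(ℝ, ℝ) ∞ c) (hw : ContMDiff I 𝓘(ℝ, ℝ) ∞ w)
    (hc₀ : ∀ b, 0 < c b) (hw₀ : ∀ b, 0 < w b) (p : B × F) {z : E × E'}
    (hz : z ∈ (extChartAt (I.prod J) p).target) (u v : E × E') :
    (bcwp gB gF c w hc hw hc₀ hw₀).inChart p z u v =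
      c ((extChartAt I p.1).symm z.1) ^ 2 * gB.inChart p.1 z.1 u.1 v.1 +
        w ((extChartAt I p.1).symm z.1) ^ 2 * gF.inChart p.2 z.2 u.2 v.2 := by
  have hz' := hz
  rw [extChartAt_prod] at hz'
  have hp : (extChartAt (I.prod J) p).symm z ∈ (chartAt (ModelProd H H') p).source := by
    rw [← extChartAt_source (I.prod J)]
    exact (extChartAt (I.prod J) p).map_target hz
  refine ((bcwp gB gF c w hc hw hc₀ hw₀).inChart_apply p hz u v).trans ?_
  rw [symmL_prod p _ hp, symmL_prod p _ hp, gB.inChart_apply p.1 hz'.1, gF.inChart_apply p.2 hz'.2]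
  exact bcwpVal_apply gB gF c w _ _ _ _ _

end ProductChart

/-! ### The Ricci tensor of the warped product -/

section RicciWarpedProduct

open Filter Topology

variable {E : Type*} [NormedAddCommGroup E] [NormedSpace ℝ E]
  {H : Type*} [TopologicalSpace H] {I : ModelWithCorners ℝ E H}
  {B : Type*} [TopologicalSpace B] [ChartedSpace H B]

/-- The logarithm of `ψ`, read in the chart at `b`. -/
noncomputable def logInChart (I : ModelWithCorners ℝ E H) (ψ : B → ℝ) (b : B) (y : E) : ℝ :=
  Real.log (ψ ((extChartAt I b).symm y))

theorem rpow_comp_symm_eq_exp {ψ : B → ℝ} (hψ₀ : ∀ b, 0 < ψ b) (a : ℝ) (b : B) :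
    (fun x ↦ ψ x ^ a) ∘ (extChartAt I b).symm = fun z ↦ Real.exp (a * logInChart I ψ b z) := by
  funext z
  rw [Function.comp_apply, Real.rpow_def_of_pos (hψ₀ _), mul_comm]
  rfl

theorem logInChart_self (ψ : B → ℝ) (b : B) :
    logInChart I ψ b (extChartAt I b b) = Real.log (ψ b) := by
  rw [logInChart, extChartAt_to_inv]

variable [IsManifold I ∞ B]
  {E' : Type*} [NormedAddCommGroup E'] [NormedSpace ℝ E']
  {H' : Type*} [TopologicalSpace H'] {J : ModelWithCorners ℝ E' H'}
  {F : Type*} [TopologicalSpace F] [ChartedSpace H' F] [IsManifold J ∞ F]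

theorem contDiffAt_logInChart [I.Boundaryless] {ψ : B → ℝ} (hψ : ContMDiff I 𝓘(ℝ, ℝ) ∞ ψ)
    (hψ₀ : ∀ b, 0 < ψ b) (b : B) :
    ContDiffAt ℝ 2 (logInChart I ψ b) (extChartAt I b b) := by
  have h : ContMDiffAt 𝓘(ℝ, E) I ∞ (extChartAt I b).symm (extChartAt I b b) :=
    (contMDiffOn_extChartAt_symm b).contMDiffAt (extChartAt_target_mem_nhds b)
  have h' : ContDiffAt ℝ 2 (ψ ∘ (extChartAt I b).symm) (extChartAt I b b) :=
    (hψ.contMDiffAt.comp _ h).contDiffAt.of_le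
      (WithTop.coe_le_coe.2 (le_top : (2 : ℕ∞) ≤ ⊤))
  exact h'.log (hψ₀ _).ne'

/-- In a product chart, `ψ^{2μ} g_B + ψ² g_F = e^{2σ} (e^{2(μ-1)σ} g_B + g_F)` with `σ = log ψ`. -/
theorem inChart_sbcwp_eventuallyEq [I.Boundaryless] [J.Boundaryless]
    (gB : PseudoRiemannianMetric I B)
    (gF : PseudoRiemannianMetric J F) (ψ : B → ℝ) (μ : ℝ) (hψ : ContMDiff I 𝓘(ℝ, ℝ) ∞ ψ)
    (hψ₀ : ∀ b, 0 < ψ b) (p : B × F) :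
    (sbcwp gB gF ψ μ hψ hψ₀).inChart p =ᶠ[𝓝 (extChartAt (I.prod J) p p)]
      conformalChange (fun z : E × E' ↦ logInChart I ψ p.1 z.1)
        (prodMetric (conformalChange (fun z ↦ (μ - 1) * logInChart I ψ p.1 z) (gB.inChart p.1))
          (gF.inChart p.2)) := by
  filter_upwards [extChartAt_target_mem_nhds (I := I.prod J) p] with z hz
  refine ContinuousLinearMap.ext fun u ↦ ContinuousLinearMap.ext fun v ↦ ?_
  refine (inChart_bcwp_apply gB gF _ _ _ _ _ _ p hz u v).trans ?_
  have hpos := hψ₀ ((extChartAt I p.1).symm z.1)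
  have h1 : ψ ((extChartAt I p.1).symm z.1) ^ 2 = Real.exp (2 * logInChart I ψ p.1 z.1) := by
    rw [logInChart, ← Real.rpow_natCast, Real.rpow_def_of_pos hpos, mul_comm, Nat.cast_ofNat]
  have h2 : (ψ ((extChartAt I p.1).symm z.1) ^ μ) ^ 2 =
      Real.exp (2 * logInChart I ψ p.1 z.1) *
        Real.exp (2 * ((μ - 1) * logInChart I ψ p.1 z.1)) := by
    rw [logInChart, Real.rpow_def_of_pos hpos, ← Real.exp_nat_mul, ← Real.exp_add]
    congr 1
    push_cast
    ring
  rw [h1, h2]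
  simp only [conformalChange, prodMetric_apply, smul_apply, smul_eq_mul]
  ring

/-- The Ricci tensor of `ψ^{2μ} g_B + ψ² g_F`, expressed through `σ = log ψ` in the charts of the
factors. -/
theorem ricci_sbcwp [FiniteDimensional ℝ E] [FiniteDimensional ℝ E'] [I.Boundaryless]
    [J.Boundaryless] (gB : PseudoRiemannianMetric I B)
    (gF : PseudoRiemannianMetric J F) (ψ : B → ℝ) (μ D Q : ℝ) (hψ : ContMDiff I 𝓘(ℝ, ℝ) ∞ ψ)
    (hψ₀ : ∀ b, 0 < ψ b) (hD : D = (Module.finrank ℝ E - 2) * μ + Module.finrank ℝ E')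
    (hQ : Q = μ * D + Module.finrank ℝ E' * (μ - 1)) (b : B) (f : F) (u v : E) (y z : E') :
    (sbcwp gB gF ψ μ hψ hψ₀).ricci (b, f) (u, y) (v, z) =
      coordRicci (gB.inChart b) (extChartAt I b b) u v +
        coordRicci (gF.inChart f) (extChartAt J f f) y z -
        D * coordHessian (gB.inChart b) (logInChart I ψ b) (extChartAt I b b) u v +
        Q * (fderiv ℝ (logInChart I ψ b) (extChartAt I b b) u *
          fderiv ℝ (logInChart I ψ b) (extChartAt I b b) v) -
        (coordLaplacian (gB.inChart b) (logInChart I ψ b) (extChartAt I b b) +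
          D * fderiv ℝ (logInChart I ψ b) (extChartAt I b b)
            (coordGradient (gB.inChart b) (logInChart I ψ b) (extChartAt I b b))) *
          (μ * gB.inChart b (extChartAt I b b) u v +
            1 / ψ b ^ (2 * (μ - 1)) * gF.inChart f (extChartAt J f f) y z) := by
  have hy : extChartAt (I.prod J) (b, f) (b, f) = (extChartAt I b b, extChartAt J f f) := by
    rw [extChartAt_prod]
    rfl
  have h1 := inChart_sbcwp_eventuallyEq gB gF ψ μ hψ hψ₀ (b, f)
  have h2 : ψ b ^ (2 * (μ - 1)) =
      Real.exp (2 * ((μ - 1) * logInChart I ψ b (extChartAt I b b))) := by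
    rw [logInChart_self, Real.rpow_def_of_pos (hψ₀ b)]
    congr 1
    ring
  refine ((sbcwp gB gF ψ μ hψ hψ₀).ricci_eq (b, f) (u, y) (v, z)).trans
    ((coordRicci_congr h1 (u, y) (v, z)).trans ?_)
  rw [hy, h2, one_div]
  exact coordRicci_warpedProduct (y := (extChartAt I b b, extChartAt J f f))
    (gB.isMetricAt_inChart b) (gF.isMetricAt_inChart f) (contDiffAt_logInChart hψ hψ₀ b) μ D Q
    hD hQ (u, y) (v, z)

/-- With `σ = log ψ`, `ψ^{-a} ∇d(ψ^a) = a ∇dσ + a² dσ ⊗ dσ`. -/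
theorem hessian_rpow [I.Boundaryless] (gB : PseudoRiemannianMetric I B) {ψ : B → ℝ}
    (hψ : ContMDiff I 𝓘(ℝ, ℝ) ∞ ψ) (hψ₀ : ∀ b, 0 < ψ b) (a : ℝ) (b : B) (u v : E) :
    1 / ψ b ^ a * gB.hessian (fun x ↦ ψ x ^ a) b u v =
      a * coordHessian (gB.inChart b) (logInChart I ψ b) (extChartAt I b b) u v +
        a ^ 2 * (fderiv ℝ (logInChart I ψ b) (extChartAt I b b) u *
          fderiv ℝ (logInChart I ψ b) (extChartAt I b b) v) := by
  have h : ψ b ^ a = Real.exp (a * logInChart I ψ b (extChartAt I b b)) := by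
    rw [logInChart_self, Real.rpow_def_of_pos (hψ₀ b), mul_comm]
  refine (congrArg (1 / ψ b ^ a * ·) (gB.hessian_eq (fun x ↦ ψ x ^ a) b u v)).trans ?_
  rw [rpow_comp_symm_eq_exp hψ₀, h,
    coordHessian_exp_const_mul (contDiffAt_logInChart hψ hψ₀ b), one_div,
    inv_mul_cancel_left₀ (Real.exp_pos _).ne']

/-- The trace of `hessian_rpow`. -/
theorem laplacian_rpow [FiniteDimensional ℝ E] [I.Boundaryless]
    (gB : PseudoRiemannianMetric I B) {ψ : B → ℝ}
    (hψ : ContMDiff I 𝓘(ℝ, ℝ) ∞ ψ) (hψ₀ : ∀ b, 0 < ψ b) (a : ℝ) (b : B) :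
    1 / ψ b ^ a * gB.laplacian (fun x ↦ ψ x ^ a) b =
      a * coordLaplacian (gB.inChart b) (logInChart I ψ b) (extChartAt I b b) +
        a ^ 2 * fderiv ℝ (logInChart I ψ b) (extChartAt I b b)
          (coordGradient (gB.inChart b) (logInChart I ψ b) (extChartAt I b b)) := by
  have h : ψ b ^ a = Real.exp (a * logInChart I ψ b (extChartAt I b b)) := by
    rw [logInChart_self, Real.rpow_def_of_pos (hψ₀ b), mul_comm]
  rw [PseudoRiemannianMetric.laplacian, rpow_comp_symm_eq_exp hψ₀, h,
    coordLaplacian_exp_const_mul (contDiffAt_logInChart hψ hψ₀ b), one_div,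
    inv_mul_cancel_left₀ (Real.exp_pos _).ne']

end RicciWarpedProduct

/-- The denominators vanish at `μbar` and at `μbar ± √(μbar² - μbar)`, respectively. -/
theorem denominators_ne_zero {m k : ℕ} (hm : 3 ≤ m) {μ μbar : ℝ} (hμbar : μbar = -(k / (m - 2)))
    (hμ : μ ∉ ({0, 1, μbar, μbar + √(μbar ^ 2 - μbar), μbar - √(μbar ^ 2 - μbar)} : Set ℝ)) :
    (m - 2) * μ + k ≠ 0 ∧ μ * ((m - 2) * μ + k) + k * (μ - 1) ≠ 0 := by
  simp only [Set.mem_insert_iff, Set.mem_singleton_iff, not_or] at hμ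
  obtain ⟨-, -, h1, h2, h3⟩ := hμ
  have hm' : (0 : ℝ) < m - 2 := by
    have : (3 : ℝ) ≤ m := by exact_mod_cast hm
    linarith
  have hk : (k : ℝ) = -μbar * (m - 2) := by
    rw [hμbar]
    field_simp
  have hneg : μbar ≤ 0 := by
    rw [hμbar]
    exact neg_nonpos.2 (by positivity)
  have hs : √(μbar ^ 2 - μbar) ^ 2 = μbar ^ 2 - μbar := Real.sq_sqrt (by nlinarith)
  have e1 : (m - 2) * μ + k = (m - 2) * (μ - μbar) := by
    rw [hk]
    ring
  have e2 : μ * ((m - 2) * μ + k) + k * (μ - 1) =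
      (m - 2) * ((μ - (μbar + √(μbar ^ 2 - μbar))) * (μ - (μbar - √(μbar ^ 2 - μbar)))) := by
    rw [hk]
    linear_combination (m - 2 : ℝ) * hs
  rw [e2, e1]
  exact ⟨mul_ne_zero hm'.ne' (sub_ne_zero.2 h1),
    mul_ne_zero hm'.ne' (mul_ne_zero (sub_ne_zero.2 h2) (sub_ne_zero.2 h3))⟩

theorem mainTheorem3 {m k : ℕ} (hm : 3 ≤ m) (hk : 1 ≤ k)
    {B : Type*} [TopologicalSpace B] [ChartedSpace (EuclideanSpace ℝ (Fin m)) B]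
    [IsManifold (𝓡 m) ∞ B]
    {F : Type*} [TopologicalSpace F] [ChartedSpace (EuclideanSpace ℝ (Fin k)) F]
    [IsManifold (𝓡 k) ∞ F]
    (gB : PseudoRiemannianMetric (𝓡 m) B) (gF : PseudoRiemannianMetric (𝓡 k) F)
    (μ μbar : ℝ) (hμbar : μbar = -(k / (m - 2)))
    (hμ : μ ∉ ({0, 1, μbar, μbar + √(μbar ^ 2 - μbar), μbar - √(μbar ^ 2 - μbar)} : Set ℝ))
    (αΔ βΔ αH βH : ℝ)
    (hαΔ : αΔ = 1 / ((m - 2) * μ + k))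
    (hβΔ : βΔ = μ / ((m - 2) * μ + k))
    (hαH : αH = -((m - 2) * μ + k) / (μ * ((m - 2) * μ + k) + k * (μ - 1)))
    (hβH : βH = ((m - 2) * μ + k) ^ 2 / (μ * ((m - 2) * μ + k) + k * (μ - 1)))
    (ψ : B → ℝ) (hψ : ContMDiff (𝓡 m) 𝓘(ℝ, ℝ) ∞ ψ) (hψ₀ : ∀ b, 0 < ψ b)
    (b : B) (f : F) :
    (∀ u v : TangentSpace (𝓡 m) b,
      (sbcwp gB gF ψ μ hψ hψ₀).ricci (b, f) (baseLift u f) (baseLift v f) =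
        gB.ricci b u v
          + βH * (1 / ψ b ^ (1 / αH)) * gB.hessian (fun x ↦ ψ x ^ (1 / αH)) b u v
          - βΔ * (1 / ψ b ^ (1 / αΔ)) * gB.laplacian (fun x ↦ ψ x ^ (1 / αΔ)) b
            * gB.val b u v) ∧
    (∀ (u : TangentSpace (𝓡 m) b) (z : TangentSpace (𝓡 k) f),
      (sbcwp gB gF ψ μ hψ hψ₀).ricci (b, f) (baseLift u f) (fiberLift b z) = 0 ∧
      (sbcwp gB gF ψ μ hψ hψ₀).ricci (b, f) (fiberLift b z) (baseLift u f) = 0) ∧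
    (∀ y z : TangentSpace (𝓡 k) f,
      (sbcwp gB gF ψ μ hψ hψ₀).ricci (b, f) (fiberLift b y) (fiberLift b z) =
        gF.ricci f y z
          - 1 / ψ b ^ (2 * (μ - 1)) * (βΔ / μ) * (1 / ψ b ^ (1 / αΔ))
            * gB.laplacian (fun x ↦ ψ x ^ (1 / αΔ)) b * gF.val f y z) := by
  obtain ⟨hD, hQ⟩ := denominators_ne_zero hm hμbar hμ
  have hμ0 : μ ≠ 0 := fun h ↦ hμ (by simp [h])
  have hR := ricci_sbcwp gB gF ψ μ ((m - 2) * μ + k) (μ * ((m - 2) * μ + k) + k * (μ - 1)) hψ hψ₀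
    (by rw [finrank_euclideanSpace_fin, finrank_euclideanSpace_fin])
    (by rw [finrank_euclideanSpace_fin]) b f
  set D : ℝ := (m - 2) * μ + k
  set Q : ℝ := μ * D + k * (μ - 1)
  have hH₁ : βH * (1 / αH) = -D := by
    rw [hβH, hαH]
    field_simp
  have hH₂ : βH * (1 / αH) ^ 2 = Q := by
    rw [hβH, hαH]
    field_simp
  have hΔ₁ : βΔ / μ * (1 / αΔ) = 1 := by
    rw [hβΔ, hαΔ]
    field_simp
  have hΔ₂ : βΔ / μ * (1 / αΔ) ^ 2 = D := by
    rw [hβΔ, hαΔ]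
    field_simp
  have hβμ : βΔ = μ * (βΔ / μ) := by field_simp
  have hL := laplacian_rpow gB hψ hψ₀ (1 / αΔ) b
  have hH := hessian_rpow gB hψ hψ₀ (1 / αH) b
  set L := coordLaplacian (gB.inChart b) (logInChart (𝓡 m) ψ b) (extChartAt (𝓡 m) b b)
  set N := fderiv ℝ (logInChart (𝓡 m) ψ b) (extChartAt (𝓡 m) b b)
    (coordGradient (gB.inChart b) (logInChart (𝓡 m) ψ b) (extChartAt (𝓡 m) b b))
  set h := coordHessian (gB.inChart b) (logInChart (𝓡 m) ψ b) (extChartAt (𝓡 m) b b)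
  set d := fderiv ℝ (logInChart (𝓡 m) ψ b) (extChartAt (𝓡 m) b b)
  -- Zeros are simplified for vectors of the model spaces, before these are read as tangent vectors.
  have hBB (u v : EuclideanSpace ℝ (Fin m)) :
      (sbcwp gB gF ψ μ hψ hψ₀).ricci (b, f) (u, (0 : EuclideanSpace ℝ (Fin k)))
        (v, (0 : EuclideanSpace ℝ (Fin k))) =
      coordRicci (gB.inChart b) (extChartAt (𝓡 m) b b) u v - D * h u v + Q * (d u * d v) -
        (L + D * N) * (μ * gB.inChart b (extChartAt (𝓡 m) b b) u v) :=
    (hR u v 0 0).trans (by simp only [coordRicci_zero_left, map_zero, mul_zero, add_zero])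
  have hBF (u : EuclideanSpace ℝ (Fin m)) (z : EuclideanSpace ℝ (Fin k)) :
      (sbcwp gB gF ψ μ hψ hψ₀).ricci (b, f) (u, (0 : EuclideanSpace ℝ (Fin k)))
        ((0 : EuclideanSpace ℝ (Fin m)), z) = 0 :=
    (hR u 0 0 z).trans (by simp [coordRicci_zero_left, coordRicci_zero_right])
  have hFB (u : EuclideanSpace ℝ (Fin m)) (z : EuclideanSpace ℝ (Fin k)) :
      (sbcwp gB gF ψ μ hψ hψ₀).ricci (b, f) ((0 : EuclideanSpace ℝ (Fin m)), z)
        (u, (0 : EuclideanSpace ℝ (Fin k))) = 0 :=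
    (hR 0 u z 0).trans (by simp [coordRicci_zero_left, coordRicci_zero_right])
  have hFF (y z : EuclideanSpace ℝ (Fin k)) :
      (sbcwp gB gF ψ μ hψ hψ₀).ricci (b, f) ((0 : EuclideanSpace ℝ (Fin m)), y)
        ((0 : EuclideanSpace ℝ (Fin m)), z) =
      coordRicci (gF.inChart f) (extChartAt (𝓡 k) f f) y z -
        (L + D * N) * (1 / ψ b ^ (2 * (μ - 1)) * gF.inChart f (extChartAt (𝓡 k) f f) y z) :=
    (hR 0 0 y z).trans
      (by simp only [coordRicci_zero_left, map_zero, mul_zero, add_zero, zero_add, sub_zero])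
  refine ⟨fun u v ↦ (hBB u v).trans ?_, fun u z ↦ ⟨hBF u z, hFB u z⟩,
    fun y z ↦ (hFF y z).trans ?_⟩
  · linear_combination -gB.ricci_eq b u v - βH * hH u v - hH₁ * h u v - hH₂ * (d u * d v) -
      (L + D * N) * μ * gB.inChart_self_apply b u v + gB.val b u v * (βΔ * hL +
        (1 / αΔ * L + (1 / αΔ) ^ 2 * N) * hβμ + μ * (L * hΔ₁ + N * hΔ₂))
  · linear_combination -gF.ricci_eq f y z -
      (L + D * N) * (1 / ψ b ^ (2 * (μ - 1))) * gF.inChart_self_apply f y z +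
      1 / ψ b ^ (2 * (μ - 1)) * gF.val f y z * (βΔ / μ * hL + L * hΔ₁ + N * hΔ₂)
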